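/- Let $n$ be a natural number and $A=\mathrm{diag}(a_1,\dots,a_n)$ a real diagonal matrix whose distinct eigenvalues $\alpha_1,\dots,\alpha_r$ have arbitrary multiplicities $k_1,\dots,k_r$. On the Lie algebra $\mathfrak{so}(n)$ of real skew-symmetric matrices put $\langle X,Y\rangle=-\tfrac12\operatorname{tr}(XY)$, let $\nabla f(M)$ be the gradient of $f$ with respect to $\langle\cdot,\cdot\rangle$, let $\Lambda_M(\xi,\eta)=-\langle M,[\xi,\eta]\rangle$, and consider the Lie–Poisson bracket $\{f,g\}(M)=\Lambda_M(\nabla f(M),\nabla g(M))$. Let $$\mathfrak{so}(n)_A=\{X\in\mathfrak{so}(n)\mid [X,A]=0\}\cong\mathfrak{so}(k_1)\oplus\dots\oplus\mathfrak{so}(k_r),$$ let $\mathcal S$ be the set of linear functions on $\mathfrak{so}(n)_A$, regarded as functions on $\mathfrak{so}(n)$ through the orthogonal projection $\mathfrak{so}(n)\to\mathfrak{so}(n)_A$, and let $$\mathcal L=\{M\mapsto\operatorname{tr}(M+\lambda A)^k\mid k=1,\dots,n,\ \lambda\in\mathbb R\}.$$ Then $\mathcal F=\mathcal L\cup\mathcal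 S$ is a complete noncommutative set of functions on $\mathfrak{so}(n)$. That is, $\mathcal F$ consists of smooth functions and is closed under $\{\cdot,\cdot\}$, and, writing $F_M=\operatorname{span}\{\nabla f(M)\mid f\in\mathcal F\}$ and $F_M^\Lambda=\{\xi\in\mathfrak{so}(n)\mid\Lambda_M(F_M,\xi)=0\}$, the following two (equivalent) completeness conditions hold: (i) for generic $M\in\mathfrak{so}(n)$ the space $F_M$ is coisotropic, i.e. $F_M^\Lambda\subseteq F_M$; (ii) there are integers $l,k\ge 0$ and functions $f_1,\dots,f_l\in\mathcal F$ such that for generic $M$ the gradients $\nabla f_1(M),\dots,\nabla f_l(M)$ form a basis of $F_M$ and $\dim(F_M\cap F_M^\Lambda)=k$, and $$l+k=\dim\mathfrak{so}(n)+\operatorname{corank}\{\cdot,\cdot\},\qquad \operatorname{corank}\{\cdot,\cdot\}=\min_{M}\dim\ker\Lambda_M .$$ Here "for generic $M$" means: for all $M\in\mathfrak{so}(n)$ outside the zero set of some polynomial in the matrix entries that does not vanish identically on $\mathfrak{so}(n)$ (in particular, on an open dense set of full measure). -/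

import Mathlib

open scoped ContDiff

-- The norm on matrices only serves to speak about derivatives (all norms are equivalent).
attribute [local instance] Matrix.normedAddCommGroup Matrix.normedSpace

-- The commutator bracket `[X, Y] = X Y - Y X` on matrices.
attribute [local instance 100] LieRing.ofAssociativeRing

namespace Manakov

noncomputable section

/-- The Lie algebra `so(n)` of real skew-symmetric `n × n` matrices. -/
abbrev so (n : ℕ) : LieSubalgebra ℝ (Matrix (Fin n) (Fin n) ℝ) :=
  LieAlgebra.Orthogonal.so (Fin n) ℝ

instance (n : ℕ) : IsTopologicalAddGroup (so n) :=
  inferInstanceAs (IsTopologicalAddGroup (so n).toSubmodule)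

theorem skew_apply {n : ℕ} (M : so n) (i j : Fin n) :
    (M : Matrix (Fin n) (Fin n) ℝ) j i = -(M : Matrix (Fin n) (Fin n) ℝ) i j := by
  have h := (LieAlgebra.Orthogonal.mem_so (Fin n) ℝ (M : Matrix (Fin n) (Fin n) ℝ)).1 M.2
  exact congrFun (congrFun h i) j

/-- The invariant scalar product `⟨X, Y⟩ = -(1/2) tr (X Y)` on `so(n)`. -/
def form (n : ℕ) : LinearMap.BilinForm ℝ (so n) :=
  LinearMap.mk₂ ℝ
    (fun X Y : so n => -(1 / 2) * Matrix.trace ((X : Matrix (Fin n) (Fin n) ℝ) * Y.1))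
    (fun X X' Y => by simp [add_mul, mul_add])
    (fun c X Y => by simp; ring)
    (fun X Y Y' => by simp [mul_add])
    (fun c X Y => by simp; ring)

theorem form_apply {n : ℕ} (X Y : so n) :
    form n X Y = -(1 / 2) * Matrix.trace ((X : Matrix (Fin n) (Fin n) ℝ) * Y.1) := rfl

theorem form_eq_sum {n : ℕ} (X Y : so n) :
    form n X Y = (1 / 2) * ∑ i, ∑ j, X.1 i j * Y.1 i j := by
  have h : Matrix.trace ((X : Matrix (Fin n) (Fin n) ℝ) * Y.1) =
      -∑ i, ∑ j, X.1 i j * Y.1 i j := by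
    rw [Matrix.trace, ← Finset.sum_neg_distrib]
    refine Finset.sum_congr rfl fun i _ => ?_
    rw [Matrix.diag_apply, Matrix.mul_apply, ← Finset.sum_neg_distrib]
    refine Finset.sum_congr rfl fun j _ => ?_
    rw [skew_apply Y i j, mul_neg]
  rw [form_apply, h]
  ring

theorem form_comm {n : ℕ} (X Y : so n) : form n X Y = form n Y X := by
  simp only [form_eq_sum, mul_comm]

theorem form_self_eq_zero {n : ℕ} (X : so n) (h : form n X X = 0) : X = 0 := by
  rw [form_eq_sum] at h
  have h0 : ∑ i, ∑ j, X.1 i j * X.1 i j = 0 := by linarith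
  have h1 := (Finset.sum_eq_zero_iff_of_nonneg
    (fun i _ => Finset.sum_nonneg fun j _ => mul_self_nonneg _)).1 h0
  apply Subtype.ext
  ext i j
  have h2 := (Finset.sum_eq_zero_iff_of_nonneg
    (fun j _ => mul_self_nonneg (X.1 i j))).1 (h1 i (Finset.mem_univ i))
  exact mul_self_eq_zero.1 (h2 j (Finset.mem_univ j))

theorem form_nondegenerate (n : ℕ) : (form n).Nondegenerate :=
  ⟨fun X h => form_self_eq_zero X (h X), fun X h => form_self_eq_zero X (h X)⟩

/-- The gradient of `f` at `M` with respect to `⟨·,·⟩`: the vector representing the differential,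
`df(M)(X) = ⟨∇f(M), X⟩`. -/
def grad {n : ℕ} (f : so n → ℝ) (M : so n) : so n :=
  ((form n).toDual (form_nondegenerate n)).symm (fderiv ℝ f M).toLinearMap

theorem form_grad {n : ℕ} (f : so n → ℝ) (M X : so n) :
    form n (grad f M) X = fderiv ℝ f M X :=
  LinearMap.BilinForm.apply_toDual_symm_apply _ _

/-- The Lie-Poisson bivector at `M`, after identifying the cotangent space with `so(n)` through
`⟨·,·⟩`: `Λ_M(ξ, η) = -⟨M, [ξ, η]⟩`. -/
def bivector {n : ℕ} (M : so n) : LinearMap.BilinForm ℝ (so n) :=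
  LinearMap.mk₂ ℝ (fun ξ η : so n => -form n M ⁅ξ, η⁆)
    (fun ξ ξ' η => by rw [add_lie, map_add]; ring)
    (fun c ξ η => by rw [smul_lie, map_smul, smul_eq_mul, smul_eq_mul]; ring)
    (fun ξ η η' => by rw [lie_add, map_add]; ring)
    (fun c ξ η => by rw [lie_smul, map_smul, smul_eq_mul, smul_eq_mul]; ring)

/-- The Lie-Poisson bracket `{f, g}(M) = -⟨M, [∇f(M), ∇g(M)]⟩` on `so(n)`. -/
def bracket {n : ℕ} (f g : so n → ℝ) : so n → ℝ :=
  fun M => bivector M (grad f M) (grad g M)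

/-- The corank of the Lie-Poisson bracket: the least, i.e. generic, dimension of `ker Λ_M`. -/
def corank (n : ℕ) : ℕ :=
  ⨅ M : so n, Module.finrank ℝ (LinearMap.ker (bivector M))

/-- `F_M`: the span of the differentials at `M` of the functions in `F`, seen in `so(n)`. -/
def diffSpan {n : ℕ} (F : Set (so n → ℝ)) (M : so n) : Submodule ℝ (so n) :=
  Submodule.span ℝ ((fun f => grad f M) '' F)

/-- The skew-orthogonal complement `W^Λ = {ξ | Λ_M(W, ξ) = 0}` of `W` at `M`. -/
def skewOrthogonal {n : ℕ} (M : so n) (W : Submodule ℝ (so n)) : Submodule ℝ (so n) :=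
  (bivector M).orthogonal W

/-- `P` holds at a generic point of `so(n)`: off the zero set of some polynomial in the matrix
entries that does not vanish identically on `so(n)`.  (Such a set of points is Zariski open and
nonempty, hence open and dense, and its complement has measure zero.) -/
def Generic {n : ℕ} (P : so n → Prop) : Prop :=
  ∃ p : MvPolynomial (Fin n × Fin n) ℝ,
    (∃ M : so n, MvPolynomial.eval (fun ij => M.1 ij.1 ij.2) p ≠ 0) ∧
    ∀ M : so n, MvPolynomial.eval (fun ij => M.1 ij.1 ij.2) p ≠ 0 → P M

/-- `F` is complete at `M`: `F_M` is coisotropic, `F_M^Λ ⊆ F_M`. -/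
def IsCompleteAt {n : ℕ} (F : Set (so n → ℝ)) (M : so n) : Prop :=
  skewOrthogonal M (diffSpan F M) ≤ diffSpan F M

/-- `F` has differential dimension `l` and differential index `k`: some `f₁, …, f_l` in `F` have
differentials that form a basis of `F_M` at a generic `M`, and there `dim ker Λ_M|_{F_M} = k`. -/
def HasDdimDind {n : ℕ} (F : Set (so n → ℝ)) (l k : ℕ) : Prop :=
  ∃ f : Fin l → so n → ℝ, (∀ i, f i ∈ F) ∧
    Generic fun M : so n =>
      LinearIndependent ℝ (fun i => grad (f i) M) ∧
      Submodule.span ℝ (Set.range fun i => grad (f i) M) = diffSpan F M ∧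
      Module.finrank ℝ ↥(diffSpan F M ⊓ skewOrthogonal M (diffSpan F M)) = k

/-- A complete noncommutative set of functions on `so(n)`: a collection of smooth functions, closed
under the Lie-Poisson bracket, complete at a generic point and (equivalently) with
`ddim F + dind F = dim so(n) + corank {·,·}`. -/
structure IsCompleteNoncommutative {n : ℕ} (F : Set (so n → ℝ)) : Prop where
  smooth : ∀ f ∈ F, ContDiff ℝ ∞ f
  bracket_mem : ∀ f ∈ F, ∀ g ∈ F, bracket f g ∈ F
  coisotropic : Generic fun M : so n => IsCompleteAt F M
  ddim_add_dind : ∃ l k : ℕ, HasDdimDind F l k ∧ l + k = Module.finrank ℝ (so n) + corank n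

/-- The Lax pair integrals `M ↦ tr (M + λ A)^k`, `k = 1, …, n`, `λ ∈ ℝ`, `A = diag(a₁, …, aₙ)`. -/
def laxIntegrals {n : ℕ} (a : Fin n → ℝ) : Set (so n → ℝ) :=
  {f | ∃ k : ℕ, 1 ≤ k ∧ k ≤ n ∧ ∃ t : ℝ,
    f = fun M : so n =>
      Matrix.trace (((M : Matrix (Fin n) (Fin n) ℝ) + t • Matrix.diagonal a) ^ k)}

/-- `so(n)_A = {X ∈ so(n) | [X, A] = 0}` for `A = diag(a₁, …, aₙ)`. -/
def isotropy {n : ℕ} (a : Fin n → ℝ) : LieSubalgebra ℝ (so n) where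
  carrier := {X | ⁅(X : Matrix (Fin n) (Fin n) ℝ), Matrix.diagonal a⁆ = 0}
  add_mem' {X Y} hX hY := by
    change ⁅(X : Matrix (Fin n) (Fin n) ℝ), Matrix.diagonal a⁆ = 0 at hX
    change ⁅(Y : Matrix (Fin n) (Fin n) ℝ), Matrix.diagonal a⁆ = 0 at hY
    change ⁅(X : Matrix (Fin n) (Fin n) ℝ) + Y.1, Matrix.diagonal a⁆ = 0
    rw [add_lie, hX, hY, add_zero]
  zero_mem' := by simp
  smul_mem' c X hX := by
    change ⁅(X : Matrix (Fin n) (Fin n) ℝ), Matrix.diagonal a⁆ = 0 at hX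
    change ⁅c • (X : Matrix (Fin n) (Fin n) ℝ), Matrix.diagonal a⁆ = 0
    rw [smul_lie, hX, smul_zero]
  lie_mem' {X Y} hX hY := by
    change ⁅(X : Matrix (Fin n) (Fin n) ℝ), Matrix.diagonal a⁆ = 0 at hX
    change ⁅(Y : Matrix (Fin n) (Fin n) ℝ), Matrix.diagonal a⁆ = 0 at hY
    change ⁅((⁅X, Y⁆ : so n) : Matrix (Fin n) (Fin n) ℝ), Matrix.diagonal a⁆ = 0
    rw [LieSubalgebra.coe_bracket, lie_lie, hX, hY]
    simp

/-- `so(n)_A` is the block diagonal subalgebra `so(k₁) ⊕ … ⊕ so(k_r)`, with one block for each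
eigenvalue of `A`. -/
theorem mem_isotropy_iff {n : ℕ} (a : Fin n → ℝ) (X : so n) :
    X ∈ isotropy a ↔ ∀ i j, a i ≠ a j → X.1 i j = 0 := by
  change ⁅(X : Matrix (Fin n) (Fin n) ℝ), Matrix.diagonal a⁆ = 0 ↔ _
  rw [Ring.lie_def, ← Matrix.ext_iff]
  refine forall_congr' fun i => forall_congr' fun j => ?_
  rw [Matrix.sub_apply, Matrix.mul_diagonal, Matrix.diagonal_mul, Matrix.zero_apply,
    show X.1 i j * a j - a i * X.1 i j = (a j - a i) * X.1 i j by ring, mul_eq_zero, sub_eq_zero]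
  constructor
  · rintro (h | h) hne
    · exact absurd h.symm hne
    · exact h
  · intro h
    by_cases hij : a i = a j
    · exact Or.inl hij.symm
    · exact Or.inr (h hij)

/-- The orthogonal projection `M ↦ M_{so(n)_A}`: the block diagonal part of `M`. -/
def proj {n : ℕ} (a : Fin n → ℝ) : so n →ₗ[ℝ] isotropy a where
  toFun M := ⟨⟨Matrix.of fun i j => if a i = a j then M.1 i j else 0, by
      rw [LieAlgebra.Orthogonal.mem_so]
      ext i j
      have h := skew_apply M i j
      by_cases hij : a i = a j
      · simp [hij, h]
      · simp [hij, Ne.symm hij]⟩, by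
      rw [mem_isotropy_iff]
      intro i j hij
      simp [hij]⟩
  map_add' M N := by
    apply Subtype.ext; apply Subtype.ext
    ext i j
    by_cases hij : a i = a j <;> simp [hij]
  map_smul' c M := by
    apply Subtype.ext; apply Subtype.ext
    ext i j
    by_cases hij : a i = a j <;> simp [hij]

/-- `M - proj a M` is orthogonal to `so(n)_A`. -/
theorem form_proj {n : ℕ} (a : Fin n → ℝ) (X : isotropy a) (M : so n) :
    form n (X : so n) (proj a M : so n) = form n (X : so n) M := by
  rw [form_eq_sum, form_eq_sum]
  congr 1
  refine Finset.sum_congr rfl fun i _ => Finset.sum_congr rfl fun j _ => ?_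
  by_cases hij : a i = a j
  · simp [proj, hij]
  · rw [(mem_isotropy_iff a X.1).1 X.2 i j hij]; simp

/-- The Noether integrals: the linear functions on `so(n)_A`, as functions on `so(n)` through the
projection `M ↦ M_{so(n)_A}`. -/
def noetherIntegrals {n : ℕ} (a : Fin n → ℝ) : Set (so n → ℝ) :=
  {f | ∃ ℓ : isotropy a →ₗ[ℝ] ℝ, f = fun M : so n => ℓ (proj a M)}

/-- Equivalently, the Noether integrals are the functions `M ↦ ⟨X, M⟩` with `X ∈ so(n)_A`. -/
theorem mem_noetherIntegrals_iff {n : ℕ} (a : Fin n → ℝ) (f : so n → ℝ) :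
    f ∈ noetherIntegrals a ↔ ∃ X ∈ isotropy a, f = fun M => form n X M := by
  constructor
  · rintro ⟨ℓ, rfl⟩
    let X := ((form n).toDual (form_nondegenerate n)).symm (ℓ ∘ₗ proj a)
    have hX : ∀ M, form n X M = ℓ (proj a M) := fun M =>
      LinearMap.BilinForm.apply_toDual_symm_apply _ _
    refine ⟨proj a X, (proj a X).2, ?_⟩
    funext M
    have hP : proj a (proj a M : so n) = proj a M := by
      apply Subtype.ext; apply Subtype.ext; ext i j
      by_cases hij : a i = a j <;> simp [proj, hij]
    calc ℓ (proj a M) = form n X (proj a M : so n) := by rw [hX, hP]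
      _ = form n (proj a M : so n) X := form_comm _ _
      _ = form n (proj a M : so n) (proj a X : so n) := (form_proj a (proj a M) X).symm
      _ = form n (proj a X : so n) (proj a M : so n) := form_comm _ _
      _ = form n (proj a X : so n) M := form_proj a (proj a X) M
  · rintro ⟨X, hX, rfl⟩
    refine ⟨(form n X) ∘ₗ (isotropy a).toSubmodule.subtype, ?_⟩
    funext M
    exact (form_proj a ⟨X, hX⟩ M).symm

end

end Manakov

namespace Manakov

/-! ### Genericity -/

theorem Generic.mono {n : ℕ} {P Q : so n → Prop} (hP : Generic P) (h : ∀ M, P M → Q M) :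
    Generic Q := by
  obtain ⟨p, hp, hPp⟩ := hP
  exact ⟨p, hp, fun M hM => h M (hPp M hM)⟩

/-- The restriction of a polynomial in the matrix entries to the line through `M` and `N`. -/
theorem exists_polynomial_eval_line {n : ℕ} (p : MvPolynomial (Fin n × Fin n) ℝ) (M N : so n) :
    ∃ q : Polynomial ℝ, ∀ t : ℝ, q.eval t =
      MvPolynomial.eval (fun ij => ((1 - t) • M + t • N : so n).1 ij.1 ij.2) p := by
  refine ⟨MvPolynomial.aeval (fun ij : Fin n × Fin n =>
    (1 - Polynomial.X) * Polynomial.C (M.1 ij.1 ij.2) +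
      Polynomial.X * Polynomial.C (N.1 ij.1 ij.2)) p, fun t => ?_⟩
  rw [← Polynomial.coe_evalRingHom, MvPolynomial.aeval_def, MvPolynomial.hom_eval₂,
    MvPolynomial.eval, MvPolynomial.coe_eval₂Hom]
  congr 1
  · ext; simp
  · ext ij; simp; ring

theorem Generic.and {n : ℕ} {P Q : so n → Prop} (hP : Generic P) (hQ : Generic Q) :
    Generic fun M => P M ∧ Q M := by
  obtain ⟨p, ⟨M, hM⟩, hp⟩ := hP
  obtain ⟨q, ⟨N, hN⟩, hq⟩ := hQ
  refine ⟨p * q, ?_, fun K hK => ?_⟩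
  · obtain ⟨p', hp'⟩ := exists_polynomial_eval_line p M N
    obtain ⟨q', hq'⟩ := exists_polynomial_eval_line q M N
    have h0 : p' ≠ 0 := by
      rintro rfl
      apply hM
      simpa using (hp' 0).symm
    have h1 : q' ≠ 0 := by
      rintro rfl
      apply hN
      simpa using (hq' 1).symm
    by_contra! h
    refine mul_ne_zero h0 h1 (Polynomial.funext fun t => ?_)
    rw [Polynomial.eval_mul, hp', hq', Polynomial.eval_zero, ← map_mul]
    exact h _
  · rw [map_mul] at hK
    exact ⟨hp K (left_ne_zero_of_mul hK), hq K (right_ne_zero_of_mul hK)⟩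

/-- The functions on `so(n)` that are polynomial in the matrix entries. -/
noncomputable def polyFun (n : ℕ) : Subalgebra ℝ (so n → ℝ) :=
  (MvPolynomial.aeval (R := ℝ)
    (fun (ij : Fin n × Fin n) (M : so n) => M.1 ij.1 ij.2)).range

theorem mem_polyFun_iff {n : ℕ} {f : so n → ℝ} :
    f ∈ polyFun n ↔ ∃ p : MvPolynomial (Fin n × Fin n) ℝ,
      ∀ M : so n, f M = MvPolynomial.eval (fun ij => M.1 ij.1 ij.2) p := by
  have h (p : MvPolynomial (Fin n × Fin n) ℝ) (M : so n) :
      MvPolynomial.aeval (R := ℝ) (fun (ij : Fin n × Fin n) (M : so n) => M.1 ij.1 ij.2) p M =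
        MvPolynomial.eval (fun ij => M.1 ij.1 ij.2) p := by
    induction p using MvPolynomial.induction_on with
    | C c => simp
    | add p q hp hq => simp [hp, hq]
    | mul_X p i hp => simp [hp]
  constructor
  · rintro ⟨p, rfl⟩
    exact ⟨p, fun M => h p M⟩
  · rintro ⟨p, hp⟩
    exact ⟨p, funext fun M => (h p M).trans (hp M).symm⟩

theorem entry_mem_polyFun {n : ℕ} (i j : Fin n) : (fun M : so n => M.1 i j) ∈ polyFun n :=
  mem_polyFun_iff.2 ⟨MvPolynomial.X (i, j), fun M => by simp⟩

theorem const_mem_polyFun {n : ℕ} (c : ℝ) : (fun _ : so n => c) ∈ polyFun n :=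
  (polyFun n).algebraMap_mem c

theorem sum_mem_polyFun {n : ℕ} {ι : Type*} {s : Finset ι} {f : ι → so n → ℝ}
    (h : ∀ i ∈ s, f i ∈ polyFun n) : (fun M => ∑ i ∈ s, f i M) ∈ polyFun n := by
  have := (polyFun n).sum_mem h
  convert this using 1
  ext M
  simp

/-- A linear functional of a matrix with polynomial entries is polynomial. -/
theorem linear_mem_polyFun {n : ℕ} {v : so n → Matrix (Fin n) (Fin n) ℝ}
    (hv : ∀ i j, (fun M => v M i j) ∈ polyFun n) (φ : Matrix (Fin n) (Fin n) ℝ →ₗ[ℝ] ℝ) :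
    (fun M => φ (v M)) ∈ polyFun n := by
  have h (M : so n) : φ (v M) = ∑ i, ∑ j, v M i j * φ (Matrix.single i j 1) := by
    conv_lhs => rw [Matrix.matrix_eq_sum_single (v M)]
    simp only [map_sum]
    refine Finset.sum_congr rfl fun i _ => Finset.sum_congr rfl fun j _ => ?_
    rw [← smul_eq_mul, ← map_smul, Matrix.smul_single, smul_eq_mul, mul_one]
  simp only [h]
  exact sum_mem_polyFun fun i _ => sum_mem_polyFun fun j _ =>
    (polyFun n).mul_mem (hv i j) (const_mem_polyFun _)

/-- A vector field on `so(n)` with polynomial entries. -/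
def IsPolyField {n : ℕ} (v : so n → so n) : Prop :=
  ∀ i j, (fun M => (v M).1 i j) ∈ polyFun n

/-- Linear independence of polynomial vector fields is an open condition. -/
theorem generic_linearIndependent {n l : ℕ} {v : Fin l → so n → so n}
    (hv : ∀ i, IsPolyField (v i)) {M₀ : so n} (h : LinearIndependent ℝ fun i => v i M₀) :
    Generic fun M => LinearIndependent ℝ fun i => v i M := by
  have h' : LinearIndependent ℝ fun i => (v i M₀).1 :=
    h.map' (so n).toSubmodule.subtype (Submodule.ker_subtype _)
  obtain ⟨φ, hφ⟩ := LinearMap.exists_leftInverse_of_injective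
    (Fintype.linearCombination ℝ fun i => (v i M₀).1)
    (LinearMap.ker_eq_bot.2 h'.fintypeLinearCombination_injective)
  have hφ' (i : Fin l) : φ (v i M₀).1 = Pi.single i 1 := by
    have := LinearMap.congr_fun hφ (Pi.single i 1)
    simpa [Fintype.linearCombination_apply_single] using this
  let D : so n → Matrix (Fin l) (Fin l) ℝ := fun M => Matrix.of fun i j => φ (v i M).1 j
  have hD : (fun M => (D M).det) ∈ polyFun n := by
    simp only [Matrix.det_apply']
    refine sum_mem_polyFun fun τ _ => (polyFun n).mul_mem (const_mem_polyFun _) ?_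
    have : (∏ i, fun M => D M (τ i) i) ∈ polyFun n := (polyFun n).prod_mem fun i _ =>
      linear_mem_polyFun (v := fun M => (v (τ i) M).1) (hv (τ i)) (LinearMap.proj i ∘ₗ φ)
    convert this using 1
    ext M
    simp
  obtain ⟨p, hp⟩ := mem_polyFun_iff.1 hD
  refine ⟨p, ⟨M₀, ?_⟩, fun M hM => ?_⟩
  · rw [← hp]
    have : D M₀ = 1 := by
      ext i j
      simp [D, hφ', Matrix.one_apply, Pi.single_apply, eq_comm]
    rw [this, Matrix.det_one]
    exact one_ne_zero
  · rw [← hp] at hM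
    have hrows : LinearIndependent ℝ (D M).row :=
      Matrix.linearIndependent_rows_of_isUnit ((Matrix.isUnit_iff_isUnit_det _).2 hM.isUnit)
    exact LinearIndependent.of_comp (φ ∘ₗ (so n).toSubmodule.subtype) hrows

/-- The dimension of the span of polynomial vector fields is lower semicontinuous. -/
theorem generic_finrank_span_le {n : ℕ} {G : Set (so n → so n)} (hG : ∀ v ∈ G, IsPolyField v)
    (M₀ : so n) :
    Generic fun M => Module.finrank ℝ (Submodule.span ℝ ((fun v => v M₀) '' G)) ≤
      Module.finrank ℝ (Submodule.span ℝ ((fun v => v M) '' G)) := by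
  obtain ⟨w, hw, -, hli⟩ :=
    Submodule.exists_fun_fin_finrank_span_eq ℝ ((fun v : so n → so n => v M₀) '' G)
  choose v hvG hv using hw
  simp only at hv
  refine (generic_linearIndependent (fun i => hG _ (hvG i)) (M₀ := M₀)
    (by simpa only [hv] using hli)).mono fun M hM => ?_
  have hsp : Submodule.span ℝ (Set.range fun i => v i M) ≤
      Submodule.span ℝ ((fun v => v M) '' G) :=
    Submodule.span_mono (by rintro _ ⟨i, rfl⟩; exact ⟨v i, hvG i, rfl⟩)
  have := Submodule.finrank_mono hsp
  rwa [finrank_span_eq_card hM, Fintype.card_fin] at this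

/-! ### Skew-symmetric parts and gradients -/

/-- The skew-symmetric part of a matrix. -/
noncomputable def skewPart (n : ℕ) : Matrix (Fin n) (Fin n) ℝ →ₗ[ℝ] so n where
  toFun B := ⟨(1 / 2 : ℝ) • (B - B.transpose), by
    rw [LieAlgebra.Orthogonal.mem_so, Matrix.transpose_smul, Matrix.transpose_sub,
      Matrix.transpose_transpose, ← smul_neg, neg_sub]⟩
  map_add' B C := by
    apply Subtype.ext
    ext i j
    simp
    ring
  map_smul' c B := by
    apply Subtype.ext
    ext i j
    simp
    ring

theorem skewPart_coe {n : ℕ} (B : Matrix (Fin n) (Fin n) ℝ) :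
    (skewPart n B).1 = (1 / 2 : ℝ) • (B - B.transpose) := rfl

theorem skewPart_apply {n : ℕ} (B : Matrix (Fin n) (Fin n) ℝ) (i j : Fin n) :
    (skewPart n B).1 i j = (1 / 2) * (B i j - B j i) := rfl

theorem transpose_coe {n : ℕ} (X : so n) : X.1.transpose = -X.1 :=
  (LieAlgebra.Orthogonal.mem_so (Fin n) ℝ X.1).1 X.2

theorem form_skewPart {n : ℕ} (B : Matrix (Fin n) (Fin n) ℝ) (X : so n) :
    form n (skewPart n B) X = -(1 / 2) * (B * X.1).trace := by
  have h : (B.transpose * X.1).trace = -(B * X.1).trace := by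
    rw [← Matrix.trace_transpose, Matrix.transpose_mul, transpose_coe, Matrix.transpose_transpose,
      neg_mul, Matrix.trace_neg, Matrix.trace_mul_comm]
  rw [form_apply, skewPart_coe, Matrix.smul_mul, sub_mul, Matrix.trace_smul, Matrix.trace_sub, h,
    smul_eq_mul]
  ring

theorem form_lie {n : ℕ} (M X Y : so n) :
    form n M ⁅X, Y⁆ = -(1 / 2) * (M.1 * (X.1 * Y.1 - Y.1 * X.1)).trace := rfl

theorem form_lie_left {n : ℕ} (M X Y : so n) : form n M ⁅X, Y⁆ = form n ⁅M, X⁆ Y := by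
  have h : form n ⁅M, X⁆ Y = -(1 / 2) * ((M.1 * X.1 - X.1 * M.1) * Y.1).trace := rfl
  rw [form_lie, h, mul_sub, sub_mul, Matrix.trace_sub, Matrix.trace_sub, mul_assoc,
    Matrix.trace_mul_comm (X.1 * M.1) Y.1, ← mul_assoc Y.1, Matrix.trace_mul_comm (Y.1 * X.1) M.1]

theorem bivector_apply {n : ℕ} (M X Y : so n) : bivector M X Y = -form n M ⁅X, Y⁆ := rfl

theorem bivector_isAlt {n : ℕ} (M : so n) : (bivector M).IsAlt := fun X => by
  rw [bivector_apply, lie_self, map_zero, neg_zero]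

theorem bivector_isRefl {n : ℕ} (M : so n) : (bivector M).IsRefl := (bivector_isAlt M).isRefl

theorem grad_eq_of_hasLineDerivAt {n : ℕ} {f : so n → ℝ} {M G : so n}
    (hf : DifferentiableAt ℝ f M) (h : ∀ X, HasLineDerivAt ℝ f (form n G X) M X) :
    grad f M = G := by
  have h0 (X : so n) : form n (grad f M - G) X = 0 := by
    rw [map_sub, LinearMap.sub_apply, form_grad, sub_eq_zero]
    exact (hf.hasFDerivAt.hasLineDerivAt X).unique (h X)
  exact sub_eq_zero.1 (form_self_eq_zero _ (h0 _))

theorem contDiff_linearMap {n : ℕ} (φ : so n →ₗ[ℝ] ℝ) : ContDiff ℝ ∞ φ :=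
  (LinearMap.toContinuousLinearMap φ).contDiff

theorem grad_form {n : ℕ} (X M : so n) : grad (fun M => form n X M) M = X := by
  refine grad_eq_of_hasLineDerivAt
    ((contDiff_linearMap (form n X)).differentiable (by simp) M) fun Y => ?_
  have : HasDerivAt (fun s : ℝ => form n X M + s * form n X Y) (form n X Y) 0 := by
    simpa using ((hasDerivAt_id (0 : ℝ)).mul_const (form n X Y)).const_add (form n X M)
  simpa only [HasLineDerivAt, map_add, map_smul, smul_eq_mul] using this

/-- The Lax matrix `M + t A`. -/
abbrev lax {n : ℕ} (a : Fin n → ℝ) (t : ℝ) (M : so n) : Matrix (Fin n) (Fin n) ℝ :=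
  M.1 + t • Matrix.diagonal a

/-- The derivative of `M ↦ (M + t A)^k`. -/
noncomputable def laxPowDeriv {n : ℕ} (a : Fin n → ℝ) (t : ℝ) (M : so n) :
    ℕ → so n →ₗ[ℝ] Matrix (Fin n) (Fin n) ℝ
  | 0 => 0
  | k + 1 => LinearMap.mulRight ℝ (lax a t M) ∘ₗ laxPowDeriv a t M k +
      LinearMap.mulLeft ℝ (lax a t M ^ k) ∘ₗ (so n).toSubmodule.subtype

theorem laxPowDeriv_succ_apply {n : ℕ} (a : Fin n → ℝ) (t : ℝ) (M : so n) (k : ℕ) (X : so n) :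
    laxPowDeriv a t M (k + 1) X = laxPowDeriv a t M k X * lax a t M + lax a t M ^ k * X.1 := rfl

theorem hasLineDerivAt_lax {n : ℕ} (a : Fin n → ℝ) (t : ℝ) (M X : so n) (i j : Fin n) :
    HasLineDerivAt ℝ (fun M : so n => lax a t M i j) (X.1 i j) M X := by
  have : HasDerivAt (fun s : ℝ => lax a t M i j + s * X.1 i j) (X.1 i j) 0 := by
    simpa using ((hasDerivAt_id (0 : ℝ)).mul_const (X.1 i j)).const_add (lax a t M i j)
  refine this.congr_of_eventuallyEq (Filter.Eventually.of_forall fun s => ?_)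
  change M.1 i j + s * X.1 i j + _ = M.1 i j + _ + s * X.1 i j
  ring

theorem hasLineDerivAt_lax_pow {n : ℕ} (a : Fin n → ℝ) (t : ℝ) (M X : so n) (k : ℕ) :
    ∀ i j, HasLineDerivAt ℝ (fun M : so n => (lax a t M ^ k) i j)
      (laxPowDeriv a t M k X i j) M X := by
  induction k with
  | zero => exact fun i j => hasDerivAt_const _ _
  | succ k ih =>
    intro i j
    simp only [pow_succ, Matrix.mul_apply, laxPowDeriv_succ_apply, Matrix.add_apply,
      ← Finset.sum_add_distrib]
    refine HasDerivAt.fun_sum fun l _ => ?_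
    have := HasDerivAt.fun_mul (ih i l) (hasLineDerivAt_lax a t M X l j)
    simp only [zero_smul, add_zero] at this
    exact this

theorem trace_laxPowDeriv_mul_pow {n : ℕ} (a : Fin n → ℝ) (t : ℝ) (M : so n) (k : ℕ) (X : so n) :
    ∀ m, (laxPowDeriv a t M k X * lax a t M ^ (m + 1)).trace =
      k * (lax a t M ^ (k + m) * X.1).trace := by
  induction k with
  | zero => intro m; simp [laxPowDeriv]
  | succ k ih =>
    intro m
    rw [laxPowDeriv_succ_apply, add_mul, Matrix.trace_add, mul_assoc, ← pow_succ', ih (m + 1),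
      Matrix.trace_mul_comm (_ * _), ← mul_assoc, ← pow_add]
    push_cast
    rw [show m + 1 + k = k + (m + 1) by ring, show k + 1 + m = k + (m + 1) by ring]
    ring

theorem trace_laxPowDeriv {n : ℕ} (a : Fin n → ℝ) (t : ℝ) (M : so n) (k : ℕ) (X : so n) :
    (laxPowDeriv a t M (k + 1) X).trace = (k + 1) * (lax a t M ^ k * X.1).trace := by
  rw [laxPowDeriv_succ_apply, Matrix.trace_add]
  rcases k with _ | k
  · simp [laxPowDeriv]
  · have := trace_laxPowDeriv_mul_pow a t M (k + 1) X 0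
    rw [zero_add, pow_one] at this
    rw [this]
    push_cast
    ring_nf

theorem contDiff_trace_lax_pow {n : ℕ} (a : Fin n → ℝ) (t : ℝ) (k : ℕ) :
    ContDiff ℝ ∞ fun M : so n => (lax a t M ^ k).trace := by
  have h1 (i j : Fin n) : ContDiff ℝ ∞ fun M : so n => lax a t M i j :=
    (contDiff_linearMap (Matrix.entryLinearMap ℝ ℝ i j ∘ₗ (so n).toSubmodule.subtype)).add
      contDiff_const
  have h (k : ℕ) : ∀ i j, ContDiff ℝ ∞ fun M : so n => (lax a t M ^ k) i j := by
    induction k with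
    | zero => exact fun i j => contDiff_const
    | succ k ih =>
      intro i j
      simp only [pow_succ, Matrix.mul_apply]
      exact ContDiff.sum fun l _ => (ih i l).mul (h1 l j)
  exact ContDiff.sum fun i _ => h k i i

theorem grad_trace_lax_pow {n : ℕ} (a : Fin n → ℝ) (t : ℝ) (k : ℕ) (M : so n) :
    grad (fun M : so n => (lax a t M ^ (k + 1)).trace) M =
      (-2 * ((k : ℝ) + 1)) • skewPart n (lax a t M ^ k) := by
  refine grad_eq_of_hasLineDerivAt
    ((contDiff_trace_lax_pow a t (k + 1)).differentiable (by simp) M) fun X => ?_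
  have h : HasLineDerivAt ℝ (fun M : so n => (lax a t M ^ (k + 1)).trace)
      (laxPowDeriv a t M (k + 1) X).trace M X :=
    HasDerivAt.fun_sum fun i _ => hasLineDerivAt_lax_pow a t M X (k + 1) i i
  rw [trace_laxPowDeriv] at h
  rw [map_smul, LinearMap.smul_apply, form_skewPart, smul_eq_mul]
  convert h using 1
  ring

/-! ### Involutivity -/

theorem lax_transpose {n : ℕ} (a : Fin n → ℝ) (t : ℝ) (M : so n) :
    (lax a t M).transpose = -M.1 + t • Matrix.diagonal a := by
  rw [Matrix.transpose_add, transpose_coe, Matrix.transpose_smul, Matrix.diagonal_transpose]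

/-- The skew-symmetric and the symmetric part `P` and `S` of a power of `M + t A` satisfy
`[P, M] + t [S, A] = 0` and `[S, M] + t [P, A] = 0`. -/
theorem exists_symmetric_part {n : ℕ} (a : Fin n → ℝ) (t : ℝ) (M : so n) (k : ℕ) :
    ∃ S : Matrix (Fin n) (Fin n) ℝ,
      (skewPart n (lax a t M ^ k)).1 * M.1 - M.1 * (skewPart n (lax a t M ^ k)).1 =
        t • (Matrix.diagonal a * S - S * Matrix.diagonal a) ∧
      S * M.1 - M.1 * S = t • (Matrix.diagonal a * (skewPart n (lax a t M ^ k)).1 -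
        (skewPart n (lax a t M ^ k)).1 * Matrix.diagonal a) := by
  have h1 : lax a t M ^ k * lax a t M = lax a t M * lax a t M ^ k := by
    rw [← pow_succ, ← pow_succ']
  have h2 := congrArg Matrix.transpose h1
  rw [Matrix.transpose_mul, Matrix.transpose_mul, lax_transpose] at h2
  suffices H : ∀ B B' M A : Matrix (Fin n) (Fin n) ℝ, B * (M + t • A) = (M + t • A) * B →
      (-M + t • A) * B' = B' * (-M + t • A) →
      (B - B') * M - M * (B - B') = t • (A * (B + B') - (B + B') * A) ∧
      (B + B') * M - M * (B + B') = t • (A * (B - B') - (B - B') * A) by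
    obtain ⟨H1, H2⟩ := H _ _ _ _ h1 h2
    refine ⟨(1 / 2 : ℝ) • (lax a t M ^ k + (lax a t M ^ k).transpose), ?_, ?_⟩ <;>
    · rw [skewPart_coe]
      simp only [Matrix.smul_mul, Matrix.mul_smul]
      rw [← smul_sub, ← smul_sub, smul_comm t]
      congr 1
  intro B B' M A h1 h2
  have e1 : B * M - M * B = t • (A * B - B * A) := by
    rw [mul_add, add_mul, Matrix.mul_smul, Matrix.smul_mul] at h1
    rw [smul_sub, sub_eq_sub_iff_add_eq_add, h1]
    abel
  have e2 : B' * M - M * B' = t • (B' * A - A * B') := by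
    rw [mul_add, add_mul, Matrix.mul_smul, Matrix.smul_mul, mul_neg, neg_mul] at h2
    rw [smul_sub, sub_eq_sub_iff_add_eq_add]
    rw [← sub_eq_zero] at h2 ⊢
    rw [← h2]
    abel
  constructor
  · calc _ = (B * M - M * B) - (B' * M - M * B') := by noncomm_ring
      _ = t • ((A * B - B * A) - (B' * A - A * B')) := by rw [e1, e2, ← smul_sub]
      _ = _ := by congr 1; noncomm_ring
  · calc _ = (B * M - M * B) + (B' * M - M * B') := by noncomm_ring
      _ = t • ((A * B - B * A) + (B' * A - A * B')) := by rw [e1, e2, ← smul_add]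
      _ = _ := by congr 1; noncomm_ring

/-- Involutivity of the Manakov integrals, for spectral parameters with `s² ≠ t²`. -/
theorem form_lie_skewPart_of_sq_ne {n : ℕ} (a : Fin n → ℝ) (M : so n) (k m : ℕ) {s t : ℝ}
    (hst : t ^ 2 ≠ s ^ 2) :
    form n M ⁅skewPart n (lax a s M ^ k), skewPart n (lax a t M ^ m)⁆ = 0 := by
  obtain ⟨S, h1, h2⟩ := exists_symmetric_part a s M k
  obtain ⟨R, h3, h4⟩ := exists_symmetric_part a t M m
  rw [form_lie]
  generalize (skewPart n (lax a s M ^ k)).1 = P at *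
  generalize (skewPart n (lax a t M ^ m)).1 = Q at *
  generalize M.1 = M at *
  generalize Matrix.diagonal a = A at *
  have cyc (X Y Z : Matrix (Fin n) (Fin n) ℝ) : (X * Y * Z).trace = (Y * (Z * X)).trace := by
    rw [mul_assoc, Matrix.trace_mul_comm, mul_assoc]
  have cyc' (X Y Z : Matrix (Fin n) (Fin n) ℝ) : (X * (Y * Z)).trace = (Z * (X * Y)).trace := by
    rw [Matrix.trace_mul_comm, mul_assoc, ← cyc, Matrix.trace_mul_comm]
  set τ := (M * (P * Q - Q * P)).trace with hτ
  have e1 : -τ = s * (S * (Q * A - A * Q)).trace := by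
    have := congrArg (fun X => (X * Q).trace) h1
    simp only [sub_mul, Matrix.smul_mul, Matrix.trace_smul, Matrix.trace_sub, smul_eq_mul] at this
    rw [hτ]
    simp only [mul_sub, Matrix.trace_sub]
    rw [cyc A S Q, cyc' M Q P, ← mul_assoc S] at *
    simp only [mul_assoc] at *
    linarith
  have e2 : t * (S * (Q * A - A * Q)).trace = s * (P * (R * A - A * R)).trace := by
    have := congrArg (fun X => (S * X).trace) h4
    have h := congrArg (fun X => (X * R).trace) h2
    simp only [sub_mul, mul_sub, Matrix.smul_mul, Matrix.mul_smul, Matrix.trace_smul,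
      Matrix.trace_sub, smul_eq_mul] at this h ⊢
    rw [cyc A P R, cyc M S R] at h
    simp only [mul_assoc] at *
    linarith
  have e3 : t * (P * (R * A - A * R)).trace = -τ := by
    have := congrArg (fun X => (P * X).trace) h3
    simp only [mul_sub, Matrix.mul_smul, Matrix.trace_smul, Matrix.trace_sub, smul_eq_mul]
      at this
    rw [hτ]
    simp only [mul_sub, Matrix.trace_sub]
    linarith [cyc' P Q M, cyc' P M Q, cyc' Q P M]
  have e4 : (t ^ 2 - s ^ 2) * τ = 0 := by
    linear_combination (-t ^ 2) * e1 + (-s * t) * e2 - s ^ 2 * e3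
  rw [(mul_eq_zero.1 e4).resolve_left (sub_ne_zero.2 hst), mul_zero]

theorem continuous_skewPart_lax_pow {n : ℕ} (a : Fin n → ℝ) (M : so n) (k : ℕ) :
    Continuous fun s : ℝ => skewPart n (lax a s M ^ k) := by
  have h : Continuous fun s : ℝ => lax a s M ^ k :=
    Continuous.pow (continuous_const.add (continuous_id.smul continuous_const)) k
  exact (LinearMap.continuous_of_finiteDimensional (skewPart n)).comp h

theorem form_lie_skewPart {n : ℕ} (a : Fin n → ℝ) (M : so n) (k m : ℕ) (s t : ℝ) :
    form n M ⁅skewPart n (lax a s M ^ k), skewPart n (lax a t M ^ m)⁆ = 0 := by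
  let φ : so n →ₗ[ℝ] ℝ := -(bivector M).flip (skewPart n (lax a t M ^ m))
  have hφ (X : so n) : φ X = form n M ⁅X, skewPart n (lax a t M ^ m)⁆ := by
    simp [φ, bivector_apply]
  have hc : Continuous fun s : ℝ => φ (skewPart n (lax a s M ^ k)) :=
    (LinearMap.continuous_of_finiteDimensional φ).comp (continuous_skewPart_lax_pow a M k)
  have hd : Dense ({t, -t} : Set ℝ)ᶜ :=
    Set.Countable.dense_compl ℝ (Set.toFinite _).countable
  have := hc.ext_on hd continuous_const (g := fun _ => 0) fun s hs => by
    change φ _ = 0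
    rw [hφ]
    refine form_lie_skewPart_of_sq_ne a M k m fun h => hs ?_
    rcases sq_eq_sq_iff_eq_or_eq_neg.1 h.symm with h | h
    · exact Or.inl h
    · exact Or.inr h
  rw [← hφ]
  exact congrFun this s

theorem form_lie_skewPart_isotropy {n : ℕ} (a : Fin n → ℝ) (M : so n) (k : ℕ) (s : ℝ) {X : so n}
    (hX : X ∈ isotropy a) : form n M ⁅skewPart n (lax a s M ^ k), X⁆ = 0 := by
  obtain ⟨S, h1, -⟩ := exists_symmetric_part a s M k
  have hXA : X.1 * Matrix.diagonal a - Matrix.diagonal a * X.1 = 0 := hX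
  rw [form_lie]
  generalize (skewPart n (lax a s M ^ k)).1 = P at *
  have h2 := congrArg (fun Y => (Y * X.1).trace) h1
  simp only [sub_mul, Matrix.smul_mul, Matrix.trace_smul, Matrix.trace_sub, smul_eq_mul] at h2
  have h3 : (Matrix.diagonal a * S * X.1).trace - (S * Matrix.diagonal a * X.1).trace = 0 := by
    rw [Matrix.trace_mul_cycle, Matrix.trace_mul_comm, ← Matrix.trace_sub, mul_assoc S, ← mul_sub,
      hXA, mul_zero, Matrix.trace_zero]
  have h4 : (M.1 * (X.1 * P)).trace = (P * M.1 * X.1).trace := by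
    rw [← mul_assoc, Matrix.trace_mul_comm, mul_assoc]
  rw [mul_sub, Matrix.trace_sub, h4, ← mul_assoc]
  rw [h3, mul_zero] at h2
  linarith

/-- The Manakov and Noether integrals are closed under the Lie-Poisson bracket. -/
theorem bracket_mem {n : ℕ} (a : Fin n → ℝ) {f g : so n → ℝ}
    (hf : f ∈ laxIntegrals a ∪ noetherIntegrals a) (hg : g ∈ laxIntegrals a ∪ noetherIntegrals a) :
    bracket f g ∈ laxIntegrals a ∪ noetherIntegrals a := by
  have hgrad {f : so n → ℝ} (hf : f ∈ laxIntegrals a) :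
      ∃ (c s : ℝ) (k : ℕ), ∀ M, grad f M = c • skewPart n (lax a s M ^ k) := by
    obtain ⟨k, hk, -, s, rfl⟩ := hf
    obtain ⟨k, rfl⟩ := Nat.exists_eq_add_of_le' hk
    exact ⟨_, s, k, grad_trace_lax_pow a s k⟩
  have h0 : (0 : so n → ℝ) ∈ noetherIntegrals a := ⟨0, by ext; simp⟩
  rcases hf with hf | hf <;> rcases hg with hg | hg
  · obtain ⟨c, s, k, hf⟩ := hgrad hf
    obtain ⟨d, t, m, hg⟩ := hgrad hg
    have : bracket f g = 0 := by
      ext M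
      rw [bracket, hf, hg, map_smul, map_smul, LinearMap.smul_apply, bivector_apply,
        form_lie_skewPart]
      simp
    exact Or.inr (this ▸ h0)
  · obtain ⟨c, s, k, hf⟩ := hgrad hf
    obtain ⟨X, hX, rfl⟩ := (mem_noetherIntegrals_iff a g).1 hg
    have : bracket f (fun M => form n X M) = 0 := by
      ext M
      rw [bracket, hf, grad_form, map_smul, LinearMap.smul_apply, bivector_apply,
        form_lie_skewPart_isotropy a M k s hX]
      simp
    exact Or.inr (this ▸ h0)
  · obtain ⟨c, s, k, hg⟩ := hgrad hg
    obtain ⟨X, hX, rfl⟩ := (mem_noetherIntegrals_iff a f).1 hf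
    have : bracket (fun M => form n X M) g = 0 := by
      ext M
      rw [bracket, hg, grad_form, map_smul, bivector_apply, ← lie_skew, map_neg,
        form_lie_skewPart_isotropy a M k s hX]
      simp
    exact Or.inr (this ▸ h0)
  · obtain ⟨X, hX, rfl⟩ := (mem_noetherIntegrals_iff a f).1 hf
    obtain ⟨Y, hY, rfl⟩ := (mem_noetherIntegrals_iff a g).1 hg
    refine Or.inr ((mem_noetherIntegrals_iff a _).2
      ⟨-⁅X, Y⁆, neg_mem ((isotropy a).lie_mem hX hY), ?_⟩)
    ext M
    rw [bracket, grad_form, grad_form, bivector_apply, form_comm, map_neg, LinearMap.neg_apply]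

/-! ### Tridiagonal matrices -/

/-- The skew-symmetric tridiagonal matrix with superdiagonal `u`. -/
noncomputable def pathMatrix {n : ℕ} (u : Fin n → ℝ) : Matrix (Fin n) (Fin n) ℝ :=
  Matrix.of fun i j =>
    if (i : ℕ) + 1 = j then u i else if (j : ℕ) + 1 = i then -u j else 0

/-- The tridiagonal matrix with diagonal `b`, superdiagonal `u` and subdiagonal `-s² u`: it is
conjugate to `s T + diag b`, where `T` is the skew-symmetric tridiagonal matrix given by `u`. -/
noncomputable def scaledPath {n : ℕ} (b u : Fin n → ℝ) (s : ℝ) : Matrix (Fin n) (Fin n) ℝ :=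
  Matrix.of fun i j =>
    if i = j then b i else if (i : ℕ) + 1 = j then u i
      else if (j : ℕ) + 1 = i then -(s ^ 2 * u j) else 0

theorem pathMatrix_transpose {n : ℕ} (u : Fin n → ℝ) :
    (pathMatrix u).transpose = -pathMatrix u := by
  ext i j
  simp only [pathMatrix, Matrix.transpose_apply, Matrix.neg_apply, Matrix.of_apply]
  split_ifs <;> first | omega | simp

theorem diagonal_pow_mul_path {n : ℕ} (b u : Fin n → ℝ) (s : ℝ) :
    Matrix.diagonal (fun i : Fin n => s ^ (i : ℕ)) * (s • pathMatrix u + Matrix.diagonal b) =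
      scaledPath b u s * Matrix.diagonal (fun i : Fin n => s ^ (i : ℕ)) := by
  ext i j
  rw [Matrix.diagonal_mul, Matrix.mul_diagonal]
  simp only [Matrix.add_apply, Matrix.smul_apply, pathMatrix, scaledPath, Matrix.of_apply,
    Matrix.diagonal_apply, smul_eq_mul]
  by_cases hij : i = j
  · subst hij
    simp
    ring
  · rw [if_neg hij, if_neg hij]
    split_ifs with h1 h2
    · rw [← h1, pow_succ]
      ring
    · rw [← h2, pow_succ]
      ring
    · ring

theorem path_pow_apply_mul {n : ℕ} (b u : Fin n → ℝ) (s : ℝ) (k : ℕ) (i j : Fin n) :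
    s ^ (i : ℕ) * ((s • pathMatrix u + Matrix.diagonal b) ^ k) i j =
      (scaledPath b u s ^ k) i j * s ^ (j : ℕ) := by
  have h : SemiconjBy (Matrix.diagonal fun i : Fin n => s ^ (i : ℕ))
      (s • pathMatrix u + Matrix.diagonal b) (scaledPath b u s) := diagonal_pow_mul_path b u s
  have := congrFun (congrFun (h.pow_right k) i) j
  rwa [Matrix.diagonal_mul, Matrix.mul_diagonal] at this

theorem path_pow_apply {n : ℕ} (b u : Fin n → ℝ) {s : ℝ} (hs : s ≠ 0) (k : ℕ) {i j : Fin n}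
    (hij : i ≤ j) : ((s • pathMatrix u + Matrix.diagonal b) ^ k) i j =
      s ^ (j - i : ℕ) * (scaledPath b u s ^ k) i j := by
  have h := path_pow_apply_mul b u s k i j
  have hp : s ^ (j : ℕ) = s ^ (i : ℕ) * s ^ (j - i : ℕ) := by
    rw [← pow_add, Nat.add_sub_cancel' hij]
  rw [hp] at h
  have := pow_ne_zero (i : ℕ) hs
  apply mul_left_cancel₀ this
  rw [h]
  ring

theorem path_pow_apply_swap {n : ℕ} (b u : Fin n → ℝ) {s : ℝ} (hs : s ≠ 0) (k : ℕ) {i j : Fin n}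
    (hij : i ≤ j) : ((s • pathMatrix u + Matrix.diagonal b) ^ k) j i =
      (-s) ^ (j - i : ℕ) * (scaledPath b u s ^ k) i j := by
  have h : (s • pathMatrix u + Matrix.diagonal b).transpose =
      (-s) • pathMatrix u + Matrix.diagonal b := by
    rw [Matrix.transpose_add, Matrix.transpose_smul, pathMatrix_transpose,
      Matrix.diagonal_transpose, smul_neg, neg_smul]
  have hK : scaledPath b u (-s) = scaledPath b u s := by
    simp only [scaledPath, neg_sq]
  rw [← Matrix.transpose_apply (_ ^ k), Matrix.transpose_pow, h,
    path_pow_apply b u (neg_ne_zero.2 hs) k hij, hK]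

theorem sum_mul_of_antisymm {n : ℕ} {c : Fin n → Fin n → ℝ} (hc : ∀ i j, c j i = -c i j)
    (B : Matrix (Fin n) (Fin n) ℝ) :
    ∑ i, ∑ j, c i j * B i j = ∑ i, ∑ j, if i < j then c i j * (B i j - B j i) else 0 := by
  have h (i j : Fin n) : c i j * B i j =
      (if i < j then c i j * B i j else 0) + if j < i then c i j * B i j else 0 := by
    rcases lt_trichotomy i j with h | h | h
    · simp [h, h.not_gt]
    · subst h
      have : c i i = 0 := by linarith [hc i i]
      simp [this]
    · simp [h, h.not_gt]
  rw [Finset.sum_congr rfl fun i _ => Finset.sum_congr rfl fun j _ => h i j]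
  simp only [Finset.sum_add_distrib]
  rw [Finset.sum_comm (f := fun i j => if j < i then c i j * B i j else 0)]
  simp only [← Finset.sum_add_distrib]
  refine Finset.sum_congr rfl fun i _ => Finset.sum_congr rfl fun j _ => ?_
  split_ifs
  · rw [hc i j]
    ring
  · ring

theorem form_skewPart_eq_sum {n : ℕ} (c : so n) (B : Matrix (Fin n) (Fin n) ℝ) :
    form n c (skewPart n B) = (1 / 2) * ∑ i, ∑ j, c.1 i j * B i j := by
  rw [form_comm, form_skewPart, Matrix.trace, neg_mul, ← mul_neg, ← Finset.sum_neg_distrib]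
  congr 1
  refine Finset.sum_congr rfl fun i _ => ?_
  rw [Matrix.diag_apply, Matrix.mul_apply, ← Finset.sum_neg_distrib]
  refine Finset.sum_congr rfl fun j _ => ?_
  rw [skew_apply c i j]
  ring

/-- The leading term of the pairing of a skew-symmetric matrix, supported at odd distances at
least `d` from the diagonal, with the powers of `s T + diag b`. -/
theorem sum_superdiagonal_eq_zero {n : ℕ} (b u : Fin n → ℝ) {c : Fin n → Fin n → ℝ}
    (hc : ∀ i j, c j i = -c i j) (hodd : ∀ i j : Fin n, i < j → Even (j - i : ℕ) → c i j = 0) {d : ℕ}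
    (hd : 0 < d) (hlt : ∀ i j : Fin n, i < j → (j - i : ℕ) < d → c i j = 0) {k : ℕ}
    (h : ∀ s : ℝ, s ≠ 0 →
      ∑ i, ∑ j, c i j * ((s • pathMatrix u + Matrix.diagonal b) ^ k) i j = 0) :
    ∑ i : Fin n, ∑ j : Fin n, (if (i : ℕ) + d = j then c i j * (scaledPath b u 0 ^ k) i j else 0) = 0 := by
  let g : ℝ → ℝ := fun s => ∑ i : Fin n, ∑ j : Fin n,
    if i < j then c i j * (s ^ ((j - i : ℕ) - d) * (scaledPath b u s ^ k) i j) else 0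
  have hK : Continuous fun s : ℝ => scaledPath b u s ^ k := by
    refine Continuous.pow (continuous_matrix fun i j => ?_) k
    simp only [scaledPath, Matrix.of_apply]
    split_ifs <;> fun_prop
  have hg : Continuous g := by
    refine continuous_finsetSum _ fun i _ => continuous_finsetSum _ fun j _ => ?_
    split_ifs
    · exact continuous_const.mul ((continuous_pow _).mul (hK.matrix_elem i j))
    · exact continuous_const
  have hg0 (s : ℝ) (hs : s ≠ 0) : g s = 0 := by
    have h1 := h s hs
    rw [sum_mul_of_antisymm hc] at h1
    have h2 : 2 * s ^ d * g s = 0 := by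
      rw [← h1, Finset.mul_sum]
      refine Finset.sum_congr rfl fun i _ => ?_
      rw [Finset.mul_sum]
      refine Finset.sum_congr rfl fun j _ => ?_
      split_ifs with hij
      · rcases Nat.even_or_odd (j - i : ℕ) with he | ho
        · simp [hodd i j hij he]
        · by_cases hjd : (j - i : ℕ) < d
          · simp [hlt i j hij hjd]
          · rw [path_pow_apply b u hs k hij.le, path_pow_apply_swap b u hs k hij.le, ho.neg_pow]
            have hp : s ^ (j - i : ℕ) = s ^ d * s ^ ((j - i : ℕ) - d) := by
              rw [← pow_add, Nat.add_sub_cancel' (not_lt.1 hjd)]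
            rw [hp]
            ring
      · simp
    exact (mul_eq_zero.1 h2).resolve_left (mul_ne_zero two_ne_zero (pow_ne_zero _ hs))
  have hg1 : g 0 = 0 := by
    have := hg.ext_on (dense_compl_singleton (0 : ℝ)) continuous_const (g := fun _ => 0)
      fun s hs => hg0 s hs
    exact congrFun this 0
  refine Eq.trans ?_ hg1
  refine Finset.sum_congr rfl fun i _ => Finset.sum_congr rfl fun j _ => ?_
  by_cases hij : i < j
  · have hij' : (i : ℕ) < j := hij
    rw [if_pos hij]
    rcases lt_trichotomy (j - i : ℕ) d with hjd | hjd | hjd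
    · rw [if_neg (by omega), hlt i j hij hjd, zero_mul]
    · rw [if_pos (by omega), hjd]
      simp
    · rw [if_neg (by omega), zero_pow (by omega)]
      ring
  · have hij' : ¬ (i : ℕ) < j := hij
    rw [if_neg hij, if_neg (by omega)]

/-! ### Bidiagonal matrices -/

theorem bidiagonal_mul_apply {n : ℕ} (b u : Fin n → ℝ) (B : Matrix (Fin n) (Fin n) ℝ)
    (i j : Fin n) : (scaledPath b u 0 * B) i j =
      b i * B i j + if h : (i : ℕ) + 1 < n then u i * B ⟨i + 1, h⟩ j else 0 := by
  have h (l : Fin n) : scaledPath b u 0 i l * B l j =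
      (if i = l then b i * B i j else 0) + if (i : ℕ) + 1 = l then u i * B l j else 0 := by
    simp only [scaledPath, Matrix.of_apply]
    split_ifs with h1 h2 h3
    · subst h1
      omega
    · subst h1
      simp
    · simp
    · simp
    · simp
  rw [Matrix.mul_apply]
  simp only [h, Finset.sum_add_distrib, Finset.sum_ite_eq, Finset.mem_univ, if_true]
  congr 1
  split_ifs with h1
  · rw [Finset.sum_eq_single ⟨i + 1, h1⟩]
    · simp
    · intro l _ hl
      rw [if_neg fun h => hl (Fin.ext h.symm)]
    · simp
  · refine Finset.sum_eq_zero fun l _ => if_neg fun h => h1 ?_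
    rw [h]
    exact l.2

theorem mul_bidiagonal_apply {n : ℕ} (b u : Fin n → ℝ) (B : Matrix (Fin n) (Fin n) ℝ)
    {i j l : Fin n} (hl : (l : ℕ) + 1 = j) : (B * scaledPath b u 0) i j =
      B i j * b j + B i l * u l := by
  have hlj : l ≠ j := by
    rintro rfl
    omega
  rw [Matrix.mul_apply, ← Finset.sum_subset (Finset.subset_univ {j, l}), Finset.sum_pair hlj.symm]
  · simp [scaledPath, hlj, hl]
  · intro m _ hm
    simp only [Finset.mem_insert, Finset.mem_singleton, not_or] at hm
    have h1 : (m : ℕ) + 1 ≠ j := fun h => hm.2 (Fin.ext (by omega))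
    simp [scaledPath, hm.1, h1]

open Polynomial in
theorem aeval_bidiagonal_apply_of_dvd {n : ℕ} (b u : Fin n → ℝ) (m : ℕ) :
    ∀ (i : Fin n) (f : ℝ[X]), (i : ℕ) + m + 1 = n → (∏ t ∈ Finset.Ici i, (X - C (b t))) ∣ f →
      ∀ j, aeval (scaledPath b u 0) f i j = 0 := by
  induction m with
  | zero =>
    rintro i f hi ⟨g, rfl⟩ j
    have : Finset.Ici i = {i} := by
      ext t
      simp only [Finset.mem_Ici, Finset.mem_singleton, Fin.le_def, Fin.ext_iff]
      omega
    rw [this, Finset.prod_singleton, map_mul, map_sub, aeval_X, aeval_C, sub_mul,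
      Matrix.sub_apply, bidiagonal_mul_apply, dif_neg (by omega), ← Algebra.smul_def,
      Matrix.smul_apply, smul_eq_mul, add_zero, sub_self]
  | succ m ih =>
    rintro i f hi ⟨g, rfl⟩ j
    have hi' : (i : ℕ) + 1 < n := by omega
    have : Finset.Ici i = insert i (Finset.Ici (⟨i + 1, hi'⟩ : Fin n)) := by
      ext t
      simp only [Finset.mem_Ici, Finset.mem_insert, Fin.le_def, Fin.ext_iff]
      omega
    rw [this, Finset.prod_insert (by simp [Fin.le_def]), mul_assoc, map_mul, map_sub, aeval_X,
      aeval_C, sub_mul, Matrix.sub_apply, bidiagonal_mul_apply, dif_pos hi', ← Algebra.smul_def,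
      Matrix.smul_apply, smul_eq_mul, add_sub_cancel_left,
      ih ⟨i + 1, hi'⟩ _ (by simp only; omega) ⟨g, rfl⟩, mul_zero]

theorem bidiagonal_pow_apply {n : ℕ} (b u : Fin n → ℝ) (k : ℕ) :
    ∀ i : Fin n, (∀ j < i, (scaledPath b u 0 ^ k) i j = 0) ∧
      (scaledPath b u 0 ^ k) i i = b i ^ k := by
  induction k with
  | zero => exact fun i => ⟨fun j hj => by simp [hj.ne'], by simp⟩
  | succ k ih =>
    intro i
    have hlt (h : (i : ℕ) + 1 < n) (j : Fin n) (hj : j ≤ i) :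
        (scaledPath b u 0 ^ k) ⟨i + 1, h⟩ j = 0 :=
      (ih _).1 j (by simp only [Fin.lt_def, Fin.le_def] at *; omega)
    refine ⟨fun j hj => ?_, ?_⟩
    · rw [pow_succ', bidiagonal_mul_apply, (ih i).1 j hj]
      split_ifs with h
      · rw [hlt h j hj.le]
        ring
      · ring
    · rw [pow_succ', bidiagonal_mul_apply, (ih i).2]
      split_ifs with h
      · rw [hlt h i le_rfl]
        ring
      · ring

open Polynomial in
theorem aeval_bidiagonal_apply_self {n : ℕ} (b u : Fin n → ℝ) (f : ℝ[X]) (i : Fin n) :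
    aeval (scaledPath b u 0) f i i = f.eval (b i) := by
  rw [aeval_eq_sum_range, eval_eq_sum_range, Matrix.sum_apply]
  simp only [Matrix.smul_apply, (bidiagonal_pow_apply b u _ i).2, smul_eq_mul]

open Polynomial in
theorem aeval_bidiagonal_apply_ne_zero {n : ℕ} (b u : Fin n → ℝ) (i : Fin n) (d : ℕ) :
    ∀ (j : Fin n) (g : ℝ[X]), (i : ℕ) + d = j → (∀ l, i ≤ l → l < j → u l ≠ 0) →
      g.eval (b i) ≠ 0 →
      aeval (scaledPath b u 0) (g * ∏ t ∈ Finset.Ioc i j, (X - C (b t))) i j ≠ 0 := by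
  induction d with
  | zero =>
    intro j g hj _ hg
    obtain rfl : i = j := Fin.ext hj
    rw [Finset.Ioc_self, Finset.prod_empty, mul_one, aeval_bidiagonal_apply_self]
    exact hg
  | succ d ih =>
    intro j g hj hu hg
    let l : Fin n := ⟨i + d, by omega⟩
    have hl : (l : ℕ) + 1 = j := by simp only [l]; omega
    have : Finset.Ioc i j = insert j (Finset.Ioc i l) := by
      ext t
      simp only [Finset.mem_Ioc, Finset.mem_insert, Fin.le_def, Fin.lt_def, Fin.ext_iff, l]
      omega
    have hjl : ¬ j ≤ l := by simp only [Fin.le_def]; omega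
    rw [this, Finset.prod_insert (by simp [hjl]), mul_comm (X - C (b j)), ← mul_assoc, map_mul,
      map_sub, aeval_X, aeval_C, mul_sub, Matrix.sub_apply, mul_bidiagonal_apply b u _ hl,
      ← Algebra.commutes, ← Algebra.smul_def, Matrix.smul_apply, smul_eq_mul, mul_comm (b j),
      add_sub_cancel_left]
    refine mul_ne_zero (ih l g rfl (fun m hm hml => hu m hm ?_) hg) (hu l ?_ ?_)
    · exact hml.trans (not_le.1 hjl)
    · simp [Fin.le_def, l]
    · exact not_le.1 hjl

open Polynomial in
/-- The entries on the `d`-th superdiagonal of the powers of a bidiagonal matrix with increasing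
diagonal `b` separate the positions `(i, j)` with `b i < b j`. -/
theorem eq_zero_of_sum_superdiagonal {n : ℕ} {b u : Fin n → ℝ} (hb : Monotone b)
    {c : Fin n → Fin n → ℝ} {d : ℕ} {Q : Fin n → Fin n → Prop}
    (h : ∀ k < n,
      ∑ i : Fin n, ∑ j : Fin n, (if (i : ℕ) + d = j then c i j * (scaledPath b u 0 ^ k) i j else 0) = 0)
    (hQ : ∀ i j, Q i j → b i < b j ∧ ∀ l, i ≤ l → l < j → u l ≠ 0)
    (hQ' : ∀ i j : Fin n, (i : ℕ) + d = j → ¬ Q i j → ∀ k, c i j * (scaledPath b u 0 ^ k) i j = 0) :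
    ∀ m : ℕ, ∀ i j : Fin n, (i : ℕ) = m → (i : ℕ) + d = j → Q i j → c i j = 0 := by
  have hf (f : ℝ[X]) (hfn : f.natDegree < n) :
      ∑ i : Fin n, ∑ j : Fin n, (if (i : ℕ) + d = j then c i j * aeval (scaledPath b u 0) f i j else 0) = 0 := by
    have h1 (i j : Fin n) :
        (if (i : ℕ) + d = j then c i j * aeval (scaledPath b u 0) f i j else 0) =
          ∑ k ∈ Finset.range n, f.coeff k *
            (if (i : ℕ) + d = j then c i j * (scaledPath b u 0 ^ k) i j else 0) := by
      rw [aeval_eq_sum_range' hfn, Matrix.sum_apply]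
      split_ifs
      · rw [Finset.mul_sum]
        refine Finset.sum_congr rfl fun k _ => ?_
        rw [Matrix.smul_apply, smul_eq_mul]
        ring
      · simp
    simp only [h1]
    rw [Finset.sum_congr rfl fun i _ => Finset.sum_comm, Finset.sum_comm]
    refine Finset.sum_eq_zero fun k hk => ?_
    simp only [← Finset.mul_sum]
    rw [h k (Finset.mem_range.1 hk), mul_zero]
  have hQf (f : ℝ[X]) (i j : Fin n) (hij : (i : ℕ) + d = j) (hn : ¬ Q i j) :
      c i j * aeval (scaledPath b u 0) f i j = 0 := by
    rw [aeval_eq_sum_range, Matrix.sum_apply, Finset.mul_sum]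
    refine Finset.sum_eq_zero fun k _ => ?_
    rw [Matrix.smul_apply, smul_eq_mul, mul_left_comm, hQ' i j hij hn, mul_zero]
  intro m
  induction m using Nat.strong_induction_on with
  | _ m ih =>
    intro i j him hij hq
    have hle : i ≤ j := by
      rw [Fin.le_def]
      omega
    set f : ℝ[X] := ∏ t ∈ Finset.Ioi i, (X - C (b t)) with hfdef
    have hdeg : f.natDegree < n := by
      rw [hfdef, natDegree_prod _ _ fun t _ => X_sub_C_ne_zero _]
      simp only [natDegree_X_sub_C, Finset.sum_const, smul_eq_mul, mul_one, Fin.card_Ioi]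
      omega
    have hsum := hf f hdeg
    rw [Finset.sum_eq_single i, Finset.sum_eq_single j, if_pos hij] at hsum
    · refine (mul_eq_zero.1 hsum).resolve_right ?_
      have hsplit : f = (∏ t ∈ Finset.Ioi j, (X - C (b t))) *
          ∏ t ∈ Finset.Ioc i j, (X - C (b t)) := by
        rw [hfdef, ← Finset.prod_union]
        · congr 1
          ext t
          simp only [Finset.mem_Ioi, Finset.mem_union, Finset.mem_Ioc, Fin.lt_def, Fin.le_def] at *
          omega
        · refine Finset.disjoint_left.2 fun t ht ht' => ?_
          exact absurd (Finset.mem_Ioi.1 ht) (not_lt.2 (Finset.mem_Ioc.1 ht').2)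
      rw [hsplit]
      refine aeval_bidiagonal_apply_ne_zero b u i d j _ hij (hQ i j hq).2 ?_
      rw [eval_prod, Finset.prod_ne_zero_iff]
      intro t ht
      rw [eval_sub, eval_X, eval_C, sub_ne_zero]
      exact ((hQ i j hq).1.trans_le (hb (Finset.mem_Ioi.1 ht).le)).ne
    · intro l _ hl
      rw [if_neg]
      exact fun h => hl (Fin.ext (by omega))
    · simp
    · intro l _ hl
      refine Finset.sum_eq_zero fun j' _ => ?_
      split_ifs with hlj
      · rcases lt_or_gt_of_ne hl with hli | hli
        · by_cases hq' : Q l j'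
          · rw [ih l (by rw [← him]; exact hli) l j' rfl hlj hq', zero_mul]
          · exact hQf f l j' hlj hq'
        · rw [aeval_bidiagonal_apply_of_dvd b u (n - 1 - l) l f (by omega), mul_zero]
          refine Finset.prod_dvd_prod_of_subset _ _ _ fun t ht => ?_
          exact Finset.mem_Ioi.2 (hli.trans_le (Finset.mem_Ici.1 ht))
      · rfl
    · simp

/-! ### Parity subspaces -/

/-- The matrices in `so(n)` whose `(x, y)` entry vanishes if `π x + π y` is odd. -/
def evenPart {n : ℕ} (π : Fin n → ℕ) : Submodule ℝ (so n) where
  carrier := {X | ∀ x y, Odd (π x + π y) → X.1 x y = 0}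
  zero_mem' _ _ _ := rfl
  add_mem' {X Y} hX hY x y h := by
    change X.1 x y + Y.1 x y = 0
    rw [hX x y h, hY x y h, add_zero]
  smul_mem' c X hX x y h := by
    change c * X.1 x y = 0
    rw [hX x y h, mul_zero]

/-- The matrices in `so(n)` whose `(x, y)` entry vanishes if `π x + π y` is even. -/
def oddPart {n : ℕ} (π : Fin n → ℕ) : Submodule ℝ (so n) where
  carrier := {X | ∀ x y, Even (π x + π y) → X.1 x y = 0}
  zero_mem' _ _ _ := rfl
  add_mem' {X Y} hX hY x y h := by
    change X.1 x y + Y.1 x y = 0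
    rw [hX x y h, hY x y h, add_zero]
  smul_mem' c X hX x y h := by
    change c * X.1 x y = 0
    rw [hX x y h, mul_zero]

theorem evenPart_sup_oddPart {n : ℕ} (π : Fin n → ℕ) : evenPart π ⊔ oddPart π = ⊤ := by
  rw [eq_top_iff]
  intro X _
  let Y : so n := ⟨Matrix.of fun x y => if Even (π x + π y) then X.1 x y else 0, by
    rw [LieAlgebra.Orthogonal.mem_so]
    ext x y
    have h := skew_apply X x y
    by_cases hxy : Even (π x + π y)
    · simp [hxy, h, add_comm (π y)]
    · simp [hxy, add_comm (π y)]⟩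
  have hY (x y : Fin n) : Y.1 x y = if Even (π x + π y) then X.1 x y else 0 := rfl
  refine Submodule.mem_sup.2 ⟨Y, fun x y h => ?_, X - Y, fun x y h => ?_, add_sub_cancel _ _⟩
  · rw [hY, if_neg (Nat.not_even_iff_odd.2 h)]
  · change X.1 x y - Y.1 x y = 0
    rw [hY, if_pos h, sub_self]

theorem bivector_eq_zero_of_mem_evenPart {n : ℕ} {π : Fin n → ℕ} {M X Y : so n}
    (hM : M ∈ oddPart π) (hX : X ∈ evenPart π) (hY : Y ∈ evenPart π) : bivector M X Y = 0 := by
  have hmul {X Y : so n} (hX : X ∈ evenPart π) (hY : Y ∈ evenPart π) {x y : Fin n}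
      (h : Odd (π x + π y)) : (X.1 * Y.1) x y = 0 := by
    rw [Matrix.mul_apply]
    refine Finset.sum_eq_zero fun z _ => ?_
    rcases Nat.even_or_odd (π x + π z) with hz | hz
    · rw [hY z y (by grind), mul_zero]
    · rw [hX x z hz, zero_mul]
  rw [bivector_apply, form_eq_sum, neg_eq_zero, mul_eq_zero]
  refine Or.inr (Finset.sum_eq_zero fun x _ => Finset.sum_eq_zero fun y _ => ?_)
  rcases Nat.even_or_odd (π x + π y) with h | h
  · rw [hM x y h, zero_mul]
  · have : (⁅X, Y⁆ : so n).1 x y = (X.1 * Y.1) x y - (Y.1 * X.1) x y := rfl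
    rw [this, hmul hX hY h, hmul hY hX h, sub_zero, mul_zero]

theorem orthogonal_top_bivector {n : ℕ} (M : so n) :
    (bivector M).orthogonal ⊤ = LinearMap.ker (bivector M) := by
  ext X
  rw [LinearMap.BilinForm.mem_orthogonal_iff, LinearMap.mem_ker]
  constructor
  · intro h
    ext Y
    exact bivector_isRefl M _ _ (h Y trivial)
  · intro h Y _
    exact bivector_isRefl M _ _ (by rw [h, LinearMap.zero_apply])

theorem bivector_eq_form {n : ℕ} (M X Y : so n) : bivector M X Y = -form n ⁅M, X⁆ Y := by
  rw [bivector_apply, form_lie_left]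

theorem mem_ker_bivector_iff {n : ℕ} (M X : so n) :
    X ∈ LinearMap.ker (bivector M) ↔ ⁅M, X⁆ = 0 := by
  rw [LinearMap.mem_ker]
  constructor
  · intro h
    apply form_self_eq_zero
    rw [← neg_eq_zero, ← bivector_eq_form, h, LinearMap.zero_apply]
  · intro h
    ext Y
    rw [bivector_eq_form, h, map_zero, LinearMap.zero_apply, neg_zero]

/-- If `M` is odd and commutes with no nonzero even element, then `ker Λ_M` is as small as
parity allows. -/
theorem finrank_add_finrank_ker_le {n : ℕ} {π : Fin n → ℕ} {M : so n} (hM : M ∈ oddPart π)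
    (h : ∀ X ∈ evenPart π, ⁅M, X⁆ = 0 → X = 0) :
    Module.finrank ℝ (so n) + Module.finrank ℝ (LinearMap.ker (bivector M)) ≤
      2 * Module.finrank ℝ (oddPart π) := by
  have hdis : Disjoint (evenPart π) (LinearMap.ker (bivector M)) :=
    Submodule.disjoint_def.2 fun X hX hX' => h X hX ((mem_ker_bivector_iff M X).1 hX')
  have h1 := LinearMap.BilinForm.finrank_add_finrank_orthogonal (bivector_isRefl M) (evenPart π)
  rw [orthogonal_top_bivector, hdis.eq_bot, finrank_bot] at h1
  have hle : evenPart π ⊔ LinearMap.ker (bivector M) ≤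
      (bivector M).orthogonal (evenPart π) := by
    refine sup_le (fun X hX Y hY => bivector_eq_zero_of_mem_evenPart hM hY hX) fun X hX Y _ => ?_
    exact bivector_isRefl M _ _ (by rw [LinearMap.mem_ker.1 hX, LinearMap.zero_apply])
  have h2 := Submodule.finrank_mono hle
  have h3 := Submodule.finrank_sup_add_finrank_inf_eq (evenPart π) (LinearMap.ker (bivector M))
  rw [hdis.eq_bot, finrank_bot] at h3
  have h4 := Submodule.finrank_add_le_finrank_add_finrank (evenPart π) (oddPart π)
  rw [evenPart_sup_oddPart, finrank_top] at h4
  omega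

/-! ### A point of maximal rank -/

/-- The skew-symmetric matrix of the path `σ 0 - σ 1 - ⋯ - σ (n - 1)`. -/
noncomputable def pathPoint {n : ℕ} (σ : Equiv.Perm (Fin n)) : so n :=
  ⟨(pathMatrix fun _ => 1).submatrix σ.symm σ.symm, by
    rw [LieAlgebra.Orthogonal.mem_so, Matrix.transpose_submatrix, pathMatrix_transpose]
    rfl⟩

theorem pathPoint_apply {n : ℕ} (σ : Equiv.Perm (Fin n)) (i j : Fin n) :
    (pathPoint σ).1 (σ i) (σ j) = pathMatrix (fun _ => 1) i j := by
  simp [pathPoint]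

/-- The position of a vertex on the path. -/
abbrev position {n : ℕ} (σ : Equiv.Perm (Fin n)) (x : Fin n) : ℕ := (σ.symm x : ℕ)

theorem pathPoint_mem_oddPart {n : ℕ} (σ : Equiv.Perm (Fin n)) :
    pathPoint σ ∈ oddPart (position σ) := by
  intro x y h
  simp only [pathPoint, pathMatrix, Matrix.submatrix_apply, Matrix.of_apply]
  rw [if_neg, if_neg] <;> grind

theorem eq_zero_of_lie_pathPoint {n : ℕ} (σ : Equiv.Perm (Fin n)) {X : so n}
    (hX : X ∈ evenPart (position σ)) (h : ⁅pathPoint σ, X⁆ = 0) : X = 0 := by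
  set T : Matrix (Fin n) (Fin n) ℝ := pathMatrix fun _ => 1 with hT
  have hcomm (i j : Fin n) : ∑ l, T i l * X.1 (σ l) (σ j) = ∑ l, X.1 (σ i) (σ l) * T l j := by
    have h1 : (pathPoint σ).1 * X.1 - X.1 * (pathPoint σ).1 = 0 := congrArg Subtype.val h
    have h2 := congrFun (congrFun (sub_eq_zero.1 h1) (σ i)) (σ j)
    rw [Matrix.mul_apply, Matrix.mul_apply, ← Equiv.sum_comp σ,
      ← Equiv.sum_comp σ fun y => X.1 (σ i) y * _] at h2
    simpa only [pathPoint_apply] using h2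
  have key (m : ℕ) : ∀ p : ℕ, ∀ i j : Fin n, (i : ℕ) = p → (i : ℕ) + 2 * m = j →
      X.1 (σ i) (σ j) = 0 := by
    induction m with
    | zero =>
      intro p i j _ hij
      obtain rfl : i = j := Fin.ext hij
      linarith [skew_apply X (σ i) (σ i)]
    | succ m ihm =>
      intro p
      induction p using Nat.strong_induction_on with
      | _ p ihp =>
        intro i j hi hij
        have hl : (j : ℕ) - 1 < n := by omega
        have hc := hcomm i ⟨j - 1, hl⟩
        rw [Finset.sum_eq_zero, Finset.sum_eq_single j] at hc
        · have : T j ⟨j - 1, hl⟩ = -1 := by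
            simp only [hT, pathMatrix, Matrix.of_apply]
            rw [if_neg (by omega), if_pos (by omega)]
          rw [this] at hc
          linarith
        · intro l _ hlj
          have hlj' : (l : ℕ) ≠ j := fun h => hlj (Fin.ext h)
          simp only [hT, pathMatrix, Matrix.of_apply]
          split_ifs with h1 h2
          · rw [ihm i i l rfl (by omega), zero_mul]
          · omega
          · rw [mul_zero]
        · simp
        · intro l _
          simp only [hT, pathMatrix, Matrix.of_apply]
          split_ifs with h1 h2
          · rw [ihm l l _ rfl (by simp only; omega), mul_zero]
          · rw [ihp l (by omega) l _ rfl (by simp only; omega), mul_zero]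
          · rw [zero_mul]
  have key' (i j : Fin n) (hij : i ≤ j) : X.1 (σ i) (σ j) = 0 := by
    rcases Nat.even_or_odd ((i : ℕ) + j) with he | ho
    · obtain ⟨r, hr⟩ := he
      have : (i : ℕ) ≤ j := hij
      exact key (r - i) i i j rfl (by omega)
    · exact hX _ _ (by simpa [position] using ho)
  apply Subtype.ext
  ext x y
  obtain ⟨i, rfl⟩ := σ.surjective x
  obtain ⟨j, rfl⟩ := σ.surjective y
  rcases le_total i j with hij | hij
  · exact key' i j hij
  · rw [skew_apply X (σ j) (σ i), key' j i hij, neg_zero]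
    rfl

/-- The vanishing of the pairing with the powers of a Lax matrix, rewritten along the path. -/
theorem sum_path_pow_eq_zero {n : ℕ} (σ : Equiv.Perm (Fin n)) {M c : so n} {β u : Fin n → ℝ}
    (hM : ∀ i j, M.1 (σ i) (σ j) = pathMatrix u i j) {k : ℕ}
    (h : ∀ t, form n c (skewPart n (lax β t M ^ k)) = 0) {s : ℝ} (hs : s ≠ 0) :
    ∑ i, ∑ j, c.1 (σ i) (σ j) *
      ((s • pathMatrix u + Matrix.diagonal (β ∘ σ)) ^ k) i j = 0 := by
  have h1 := h s⁻¹
  rw [form_skewPart_eq_sum, ← Equiv.sum_comp σ] at h1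
  have h2 : s • pathMatrix u + Matrix.diagonal (β ∘ σ) =
      s • Matrix.reindexAlgEquiv ℝ ℝ σ.symm (lax β s⁻¹ M) := by
    ext i j
    simp [hM, Matrix.diagonal_apply, mul_add, hs]
  have h3 (i j : Fin n) : c.1 (σ i) (σ j) *
      ((s • pathMatrix u + Matrix.diagonal (β ∘ σ)) ^ k) i j =
        s ^ k * (c.1 (σ i) (σ j) * (lax β s⁻¹ M ^ k) (σ i) (σ j)) := by
    rw [h2, smul_pow, ← map_pow, Matrix.smul_apply, smul_eq_mul, Matrix.coe_reindexAlgEquiv,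
      Matrix.reindex_apply, Matrix.submatrix_apply, Equiv.symm_symm]
    ring
  simp only [h3, ← Finset.mul_sum]
  rw [Finset.sum_congr rfl fun i _ => Equiv.sum_comp σ fun y => c.1 (σ i) y *
    (lax β s⁻¹ M ^ k) (σ i) y, (mul_eq_zero.1 h1).resolve_left (by norm_num), mul_zero]

/-- An odd element orthogonal to all `skewPart ((M + t A)^k)`, `k < n`, and to all
`skewPart ((M_{so(n)_A} + t A')^k)`, where `A'` has simple spectrum, vanishes. -/
theorem eq_zero_of_mem_oddPart {n : ℕ} {a : Fin n → ℝ} (σ : Equiv.Perm (Fin n))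
    (hσ : Monotone (a ∘ σ)) {c : so n} (hc : c ∈ oddPart (position σ))
    (h1 : ∀ k < n, ∀ t, form n c (skewPart n (lax a t (pathPoint σ) ^ k)) = 0)
    (h2 : ∀ k t, form n c
      (skewPart n (lax (fun x => (position σ x : ℝ)) t (proj a (pathPoint σ) : so n) ^ k)) = 0) :
    c = 0 := by
  let u : Fin n → ℝ := fun i =>
    if h : (i : ℕ) + 1 < n then if a (σ i) = a (σ ⟨i + 1, h⟩) then 1 else 0 else 0
  have hproj (i j : Fin n) :
      (proj a (pathPoint σ) : so n).1 (σ i) (σ j) = pathMatrix u i j := by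
    change (if a (σ i) = a (σ j) then (pathPoint σ).1 (σ i) (σ j) else 0) = _
    rw [pathPoint_apply]
    simp only [pathMatrix, Matrix.of_apply, u]
    by_cases hij : (i : ℕ) + 1 = j
    · have : (⟨i + 1, by omega⟩ : Fin n) = j := Fin.ext hij
      rw [if_pos hij, if_pos hij, dif_pos (by omega), this]
    · by_cases hji : (j : ℕ) + 1 = i
      · have : (⟨j + 1, by omega⟩ : Fin n) = i := Fin.ext hji
        rw [if_neg hij, if_neg hij, if_pos hji, if_pos hji, dif_pos (by omega), this]
        by_cases ha : a (σ i) = a (σ j)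
        · simp [ha]
        · simp [ha, Ne.symm ha]
      · simp [hij, hji]
  have hanti (i j : Fin n) : c.1 (σ j) (σ i) = -c.1 (σ i) (σ j) := skew_apply c _ _
  have hodd (i j : Fin n) (hij : i < j) (he : Even (j - i : ℕ)) : c.1 (σ i) (σ j) = 0 := by
    refine hc _ _ ?_
    have : (i : ℕ) < j := hij
    simp only [position, Equiv.symm_apply_apply]
    grind
  have hpos : (fun x => (position σ x : ℝ)) ∘ σ = fun i : Fin n => ((i : ℕ) : ℝ) := by
    ext i
    simp [position]
  set ι : Fin n → ℝ := fun i => ((i : ℕ) : ℝ) with hι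
  have hιm : Monotone ι := fun i j hij => by
    simp only [hι]
    exact_mod_cast hij
  have hcommute (k : ℕ) (i j : Fin n) (hij : a (σ i) ≠ a (σ j)) :
      (scaledPath ι u 0 ^ k) i j = 0 := by
    have hcm : Commute (scaledPath ι u 0) (Matrix.diagonal (a ∘ σ)) := by
      ext i j
      rw [Matrix.mul_diagonal, Matrix.diagonal_mul]
      simp only [scaledPath, Matrix.of_apply, Function.comp_apply, u]
      split_ifs with e1 e2 e3 e4 e5
      · rw [e1]
        ring
      · have : (⟨i + 1, e3⟩ : Fin n) = j := Fin.ext e2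
        rw [e4, this]
        ring
      all_goals simp
    have := congrFun (congrFun (hcm.pow_left k) i) j
    rw [Matrix.mul_diagonal, Matrix.diagonal_mul, Function.comp_apply, Function.comp_apply,
      mul_comm] at this
    by_contra hne
    exact hij (mul_right_cancel₀ hne this).symm
  have key (d : ℕ) : ∀ i j : Fin n, i < j → (j - i : ℕ) = d → c.1 (σ i) (σ j) = 0 := by
    induction d using Nat.strong_induction_on with
    | _ d ih =>
      rcases Nat.eq_zero_or_pos d with rfl | hd
      · intro i j hij hd
        have : (i : ℕ) < j := hij
        omega
      have hlt (i j : Fin n) (hij : i < j) (hlt : (j - i : ℕ) < d) : c.1 (σ i) (σ j) = 0 :=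
        ih _ hlt i j hij rfl
      have heq : ∀ i j : Fin n, (i : ℕ) + d = j → a (σ i) = a (σ j) → c.1 (σ i) (σ j) = 0 := by
        intro i j hij hQ
        refine eq_zero_of_sum_superdiagonal (b := ι) (u := u) hιm (d := d)
          (c := fun i j => c.1 (σ i) (σ j)) (Q := fun i j => i < j ∧ a (σ i) = a (σ j))
          (fun k _ => sum_superdiagonal_eq_zero ι u hanti hodd hd hlt fun s hs => ?_) ?_ ?_
          i i j rfl hij ⟨?_, hQ⟩
        · rw [← hpos]
          exact sum_path_pow_eq_zero σ hproj (h2 k) hs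
        · rintro i j ⟨hij, ha⟩
          refine ⟨by simp only [hι]; exact_mod_cast hij, fun l hil hlj => ?_⟩
          have hl : (l : ℕ) + 1 < n := lt_of_le_of_lt (Nat.succ_le_of_lt hlj) j.2
          have e1 : a (σ i) ≤ a (σ l) := hσ hil
          have e2 : a (σ l) ≤ a (σ ⟨l + 1, hl⟩) := hσ (by simp [Fin.le_def])
          have e3 : a (σ ⟨l + 1, hl⟩) ≤ a (σ j) := hσ (by
            rw [Fin.le_def]
            exact Nat.succ_le_of_lt hlj)
          simp only [u]
          rw [dif_pos hl, if_pos (by linarith)]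
          exact one_ne_zero
        · intro i j hij hn k
          rw [hcommute k i j fun ha => hn ⟨by rw [Fin.lt_def]; omega, ha⟩, mul_zero]
        · rw [Fin.lt_def]
          omega
      intro i j hij hd'
      have hij' : (i : ℕ) < j := hij
      by_cases ha : a (σ i) = a (σ j)
      · exact heq i j (by omega) ha
      refine eq_zero_of_sum_superdiagonal (b := a ∘ σ) (u := fun _ => 1) hσ (d := d)
        (c := fun i j => c.1 (σ i) (σ j)) (Q := fun i j => a (σ i) < a (σ j))
        (fun k hk => sum_superdiagonal_eq_zero _ _ hanti hodd hd hlt fun s hs =>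
          sum_path_pow_eq_zero σ (pathPoint_apply σ) (h1 k hk) hs)
        (fun i j h => ⟨h, fun _ _ _ => one_ne_zero⟩) (fun i j hij hn k => ?_)
        i i j rfl (by omega) (lt_of_le_of_ne (hσ hij.le) ha)
      have hle : a (σ i) ≤ a (σ j) := hσ (by rw [Fin.le_def]; omega)
      rw [heq i j hij (le_antisymm hle (not_lt.1 hn)), zero_mul]
  apply Subtype.ext
  ext x y
  obtain ⟨i, rfl⟩ := σ.surjective x
  obtain ⟨j, rfl⟩ := σ.surjective y
  rcases lt_trichotomy i j with hij | rfl | hij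
  · exact key _ i j hij rfl
  · have := hanti i i
    change c.1 (σ i) (σ i) = 0
    linarith
  · rw [hanti j i, key _ j i hij rfl, neg_zero]
    rfl

/-! ### A generic Lagrangian subspace -/

theorem lax_pow_mem_polyFun {n : ℕ} (β : Fin n → ℝ) (t : ℝ) {v : so n → so n}
    (hv : IsPolyField v) (k : ℕ) :
    ∀ i j, (fun M => (lax β t (v M) ^ k) i j) ∈ polyFun n := by
  induction k with
  | zero => exact fun i j => const_mem_polyFun _
  | succ k ih =>
    intro i j
    simp only [pow_succ, Matrix.mul_apply]
    exact sum_mem_polyFun fun l _ => (polyFun n).mul_mem (ih i l)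
      ((polyFun n).add_mem (hv l j) (const_mem_polyFun _))

theorem IsPolyField.skewPart_lax_pow {n : ℕ} (β : Fin n → ℝ) (t : ℝ) {v : so n → so n}
    (hv : IsPolyField v) (k : ℕ) : IsPolyField fun M => skewPart n (lax β t (v M) ^ k) :=
  fun i j => (polyFun n).mul_mem (const_mem_polyFun _)
    ((polyFun n).sub_mem (lax_pow_mem_polyFun β t hv k i j) (lax_pow_mem_polyFun β t hv k j i))

theorem isPolyField_id {n : ℕ} : IsPolyField fun M : so n => M := entry_mem_polyFun

theorem isPolyField_proj {n : ℕ} (a : Fin n → ℝ) :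
    IsPolyField fun M : so n => (proj a M : so n) := by
  intro i j
  change (fun M : so n => if a i = a j then M.1 i j else 0) ∈ polyFun n
  split_ifs
  · exact entry_mem_polyFun i j
  · exact const_mem_polyFun 0

theorem isPolyField_lie {n : ℕ} (X : so n) : IsPolyField fun M : so n => ⁅M, X⁆ := by
  intro i j
  change (fun M : so n => (M.1 * X.1) i j - (X.1 * M.1) i j) ∈ polyFun n
  simp only [Matrix.mul_apply]
  refine (polyFun n).sub_mem ?_ ?_
  · exact sum_mem_polyFun fun l _ =>
      (polyFun n).mul_mem (entry_mem_polyFun i l) (const_mem_polyFun _)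
  · exact sum_mem_polyFun fun l _ =>
      (polyFun n).mul_mem (const_mem_polyFun _) (entry_mem_polyFun l j)

/-- The vector fields spanning a generic Lagrangian subspace of `F_M`: the gradients of the Manakov
integrals of `M` and the gradients, at the projection of `M` to `so(n)_A`, of the Manakov integrals
given by a second diagonal matrix. -/
def lagrangianFields {n : ℕ} (a β : Fin n → ℝ) : Set (so n → so n) :=
  {v | ∃ k < n, ∃ t : ℝ, v = fun M => skewPart n (lax a t M ^ k)} ∪
    {v | ∃ (k : ℕ) (t : ℝ), v = fun M => skewPart n (lax β t (proj a M : so n) ^ k)}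

theorem isPolyField_of_mem_lagrangianFields {n : ℕ} {a β : Fin n → ℝ} {v : so n → so n}
    (hv : v ∈ lagrangianFields a β) : IsPolyField v := by
  rcases hv with ⟨k, -, t, rfl⟩ | ⟨k, t, rfl⟩
  · exact isPolyField_id.skewPart_lax_pow a t k
  · exact (isPolyField_proj a).skewPart_lax_pow β t k

/-- The span of the Lagrangian vector fields at `M`. -/
def lagrangianSpan {n : ℕ} (a β : Fin n → ℝ) (M : so n) : Submodule ℝ (so n) :=
  Submodule.span ℝ ((fun v => v M) '' lagrangianFields a β)

theorem skewPart_lax_proj_mem_isotropy {n : ℕ} (a β : Fin n → ℝ) (M : so n) (k : ℕ) (t : ℝ) :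
    skewPart n (lax β t (proj a M : so n) ^ k) ∈ isotropy a := by
  have hP : (proj a M : so n).1 * Matrix.diagonal a - Matrix.diagonal a * (proj a M : so n).1 = 0 :=
    (proj a M).2
  have hL : Commute (lax β t (proj a M : so n)) (Matrix.diagonal a) :=
    Commute.add_left (sub_eq_zero.1 hP)
      ((Matrix.commute_diagonal β a).smul_left t)
  have h (i j : Fin n) (hij : a i ≠ a j) : (lax β t (proj a M : so n) ^ k) i j = 0 := by
    have := congrFun (congrFun (hL.pow_left k) i) j
    rw [Matrix.mul_diagonal, Matrix.diagonal_mul, mul_comm] at this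
    by_contra hne
    exact hij (mul_right_cancel₀ hne this).symm
  rw [mem_isotropy_iff]
  intro i j hij
  rw [skewPart_apply, h i j hij, h j i hij.symm]
  ring

theorem form_lie_proj {n : ℕ} (a : Fin n → ℝ) (M : so n) {X Y : so n} (hX : X ∈ isotropy a)
    (hY : Y ∈ isotropy a) : form n M ⁅X, Y⁆ = form n (proj a M : so n) ⁅X, Y⁆ := by
  have := form_proj a ⟨⁅X, Y⁆, (isotropy a).lie_mem hX hY⟩ M
  rw [form_comm, ← this, form_comm]

theorem lagrangianSpan_le_skewOrthogonal {n : ℕ} (a β : Fin n → ℝ) (M : so n) :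
    lagrangianSpan a β M ≤ skewOrthogonal M (lagrangianSpan a β M) := by
  have key : ∀ v ∈ lagrangianFields a β, ∀ w ∈ lagrangianFields a β,
      bivector M (v M) (w M) = 0 := by
    rintro v (⟨k, -, t, rfl⟩ | ⟨k, t, rfl⟩) w (⟨m, -, s, rfl⟩ | ⟨m, s, rfl⟩)
    · rw [bivector_apply, form_lie_skewPart, neg_zero]
    · rw [bivector_apply, form_lie_skewPart_isotropy a M k t
        (skewPart_lax_proj_mem_isotropy a β M m s), neg_zero]
    · refine bivector_isRefl M _ _ ?_
      rw [bivector_apply, form_lie_skewPart_isotropy a M m s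
        (skewPart_lax_proj_mem_isotropy a β M k t), neg_zero]
    · rw [bivector_apply, form_lie_proj a M (skewPart_lax_proj_mem_isotropy a β M k t)
        (skewPart_lax_proj_mem_isotropy a β M m s), form_lie_skewPart, neg_zero]
  refine Submodule.span_le.2 ?_
  rintro _ ⟨w, hw, rfl⟩ X hX
  change bivector M X (w M) = 0
  have hle : lagrangianSpan a β M ≤ LinearMap.ker ((bivector M).flip (w M)) := by
    refine Submodule.span_le.2 ?_
    rintro _ ⟨v, hv, rfl⟩
    exact key v hv w hw
  exact hle hX

theorem exists_finrank_add_finrank_ker_le {n : ℕ} (a : Fin n → ℝ) :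
    ∃ (β : Fin n → ℝ) (M : so n),
      Module.finrank ℝ (so n) + Module.finrank ℝ (LinearMap.ker (bivector M)) ≤
        2 * Module.finrank ℝ (lagrangianSpan a β M) := by
  set σ := Tuple.sort a
  refine ⟨fun x => (position σ x : ℝ), pathPoint σ, ?_⟩
  set W := lagrangianSpan a (fun x => (position σ x : ℝ)) (pathPoint σ)
  have h1 := finrank_add_finrank_ker_le (pathPoint_mem_oddPart σ)
    fun X hX h => eq_zero_of_lie_pathPoint σ hX h
  have hdis : Disjoint ((form n).orthogonal W) (oddPart (position σ)) := by
    refine Submodule.disjoint_def.2 fun c hc hc' => ?_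
    refine eq_zero_of_mem_oddPart σ (Tuple.monotone_sort a) hc' (fun k hk t => ?_) fun k t => ?_
    · rw [form_comm]
      exact hc _ (Submodule.subset_span ⟨_, Or.inl ⟨k, hk, t, rfl⟩, rfl⟩)
    · rw [form_comm]
      exact hc _ (Submodule.subset_span ⟨_, Or.inr ⟨k, t, rfl⟩, rfl⟩)
  have h2 := Submodule.finrank_add_finrank_le_of_disjoint hdis
  have h3 := LinearMap.BilinForm.finrank_orthogonal (form_nondegenerate n) W
  have h4 := Submodule.finrank_le W
  omega

theorem generic_finrank_ker_eq_corank (n : ℕ) :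
    Generic fun M : so n => Module.finrank ℝ (LinearMap.ker (bivector M)) = corank n := by
  obtain ⟨M₀, hM₀⟩ := ciInf_mem fun M : so n => Module.finrank ℝ (LinearMap.ker (bivector M))
  let G : Set (so n → so n) := Set.range fun X : so n => fun M => ⁅M, X⁆
  have hG : ∀ v ∈ G, IsPolyField v := by
    rintro _ ⟨X, rfl⟩
    exact isPolyField_lie X
  have hrank (M : so n) : Module.finrank ℝ (Submodule.span ℝ ((fun v => v M) '' G)) +
      Module.finrank ℝ (LinearMap.ker (bivector M)) = Module.finrank ℝ (so n) := by
    let φ : so n →ₗ[ℝ] so n := (LieAlgebra.ad ℝ (so n) M : so n →ₗ[ℝ] so n)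
    have h1 : LinearMap.ker (bivector M) = LinearMap.ker φ := by
      ext X
      rw [mem_ker_bivector_iff, LinearMap.mem_ker, LieAlgebra.ad_apply]
    have h2 : (fun v : so n → so n => v M) '' G = (LinearMap.range φ : Set (so n)) := by
      rw [← Set.range_comp]
      ext Y
      simp [φ]
    rw [h1, h2, Submodule.span_eq, LinearMap.finrank_range_add_finrank_ker]
  refine (generic_finrank_span_le hG M₀).mono fun M hM => le_antisymm ?_ ?_
  · have e1 := hrank M
    have e2 := hrank M₀
    change Module.finrank ℝ (LinearMap.ker (bivector M₀)) = corank n at hM₀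
    omega
  · exact ciInf_le (OrderBot.bddBelow _) M

/-! ### Completeness -/

theorem skewPart_mem_diffSpan {n : ℕ} (a : Fin n → ℝ) (M : so n) {k : ℕ} (hk : k < n) (t : ℝ) :
    skewPart n (lax a t M ^ k) ∈ diffSpan (laxIntegrals a ∪ noetherIntegrals a) M := by
  have hmem : (fun M : so n => (lax a t M ^ (k + 1)).trace) ∈
      laxIntegrals a ∪ noetherIntegrals a := Or.inl ⟨k + 1, by omega, by omega, t, rfl⟩
  have h := Submodule.subset_span (R := ℝ) (Set.mem_image_of_mem (fun f => grad f M) hmem)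
  simp only [grad_trace_lax_pow] at h
  refine (Submodule.smul_mem_iff _ ?_).1 h
  have : (0 : ℝ) < (k : ℝ) + 1 := by positivity
  exact mul_ne_zero (by norm_num) this.ne'

theorem mem_diffSpan_of_mem_isotropy {n : ℕ} (a : Fin n → ℝ) (M : so n) {X : so n}
    (hX : X ∈ isotropy a) : X ∈ diffSpan (laxIntegrals a ∪ noetherIntegrals a) M := by
  have hmem : (fun M => form n X M) ∈ laxIntegrals a ∪ noetherIntegrals a :=
    Or.inr ((mem_noetherIntegrals_iff a _).2 ⟨X, hX, rfl⟩)
  have h := Submodule.subset_span (R := ℝ) (Set.mem_image_of_mem (fun f => grad f M) hmem)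
  simp only [grad_form] at h
  exact h

theorem lagrangianSpan_le_diffSpan {n : ℕ} (a β : Fin n → ℝ) (M : so n) :
    lagrangianSpan a β M ≤ diffSpan (laxIntegrals a ∪ noetherIntegrals a) M := by
  refine Submodule.span_le.2 ?_
  rintro _ ⟨v, ⟨k, hk, t, rfl⟩ | ⟨k, t, rfl⟩, rfl⟩
  · exact skewPart_mem_diffSpan a M hk t
  · exact mem_diffSpan_of_mem_isotropy a M (skewPart_lax_proj_mem_isotropy a β M k t)

theorem generic_isCompleteAt {n : ℕ} (a : Fin n → ℝ) :
    Generic fun M : so n => IsCompleteAt (laxIntegrals a ∪ noetherIntegrals a) M := by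
  obtain ⟨β, M₀, hM₀⟩ := exists_finrank_add_finrank_ker_le a
  refine ((generic_finrank_span_le
    (fun v hv => isPolyField_of_mem_lagrangianFields (a := a) (β := β) hv) M₀).and
    (generic_finrank_ker_eq_corank n)).mono fun M hM => ?_
  obtain ⟨h1, h2⟩ := hM
  change Module.finrank ℝ (lagrangianSpan a β M₀) ≤
    Module.finrank ℝ (lagrangianSpan a β M) at h1
  have h3 : corank n ≤ Module.finrank ℝ (LinearMap.ker (bivector M₀)) :=
    ciInf_le (OrderBot.bddBelow _) M₀
  have h4 := LinearMap.BilinForm.finrank_add_finrank_orthogonal (bivector_isRefl M)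
    (lagrangianSpan a β M)
  rw [orthogonal_top_bivector] at h4
  have h5 := Submodule.finrank_mono
    (inf_le_right : lagrangianSpan a β M ⊓ LinearMap.ker (bivector M) ≤ _)
  have h6 : lagrangianSpan a β M = skewOrthogonal M (lagrangianSpan a β M) := by
    refine Submodule.eq_of_le_of_finrank_le (lagrangianSpan_le_skewOrthogonal a β M) ?_
    rw [skewOrthogonal]
    omega
  have hle := lagrangianSpan_le_diffSpan a β M
  refine le_trans ?_ hle
  rw [h6]
  exact LinearMap.BilinForm.orthogonal_le hle

theorem finrank_inf_skewOrthogonal {n : ℕ} {F : Set (so n → ℝ)} {M : so n}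
    (h : IsCompleteAt F M) : Module.finrank ℝ (diffSpan F M) +
      Module.finrank ℝ ↥(diffSpan F M ⊓ skewOrthogonal M (diffSpan F M)) =
        Module.finrank ℝ (so n) + Module.finrank ℝ (LinearMap.ker (bivector M)) := by
  have h1 := LinearMap.BilinForm.finrank_add_finrank_orthogonal (bivector_isRefl M) (diffSpan F M)
  have h2 : LinearMap.ker (bivector M) ≤ diffSpan F M := by
    refine le_trans ?_ h
    rw [← orthogonal_top_bivector]
    exact LinearMap.BilinForm.orthogonal_le le_top
  rw [orthogonal_top_bivector, inf_eq_right.2 h2] at h1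
  rw [inf_eq_right.2 h]
  exact h1

/-- Completeness in the sense of dimensions follows from completeness at generic points, for sets of
functions with polynomial gradients. -/
theorem exists_hasDdimDind {n : ℕ} {F : Set (so n → ℝ)} (hF : ∀ f ∈ F, IsPolyField (grad f))
    (h : Generic fun M : so n => IsCompleteAt F M) :
    ∃ l k : ℕ, HasDdimDind F l k ∧ l + k = Module.finrank ℝ (so n) + corank n := by
  have hbdd : BddAbove (Set.range fun M : so n => Module.finrank ℝ (diffSpan F M)) :=
    ⟨Module.finrank ℝ (so n), by rintro _ ⟨M, rfl⟩; exact Submodule.finrank_le _⟩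
  obtain ⟨M₀, hM₀⟩ := Nat.sSup_mem (Set.range_nonempty _) hbdd
  have hmax (M : so n) : Module.finrank ℝ (diffSpan F M) ≤ Module.finrank ℝ (diffSpan F M₀) := by
    simp only at hM₀
    rw [hM₀]
    exact le_csSup hbdd ⟨M, rfl⟩
  obtain ⟨w, hw, -, hli⟩ :=
    Submodule.exists_fun_fin_finrank_span_eq ℝ ((fun f => grad f M₀) '' F)
  choose f hfF hf using hw
  simp only at hf
  have hgen := generic_linearIndependent (fun i => hF _ (hfF i)) (M₀ := M₀)
    (by simpa only [hf] using hli)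
  refine ⟨Module.finrank ℝ (diffSpan F M₀),
    Module.finrank ℝ (so n) + corank n - Module.finrank ℝ (diffSpan F M₀), ⟨f, hfF, ?_⟩, ?_⟩
  · refine ((hgen.and h).and (generic_finrank_ker_eq_corank n)).mono fun M hM => ?_
    obtain ⟨⟨h1, h2⟩, h3⟩ := hM
    have hspan : Submodule.span ℝ (Set.range fun i => grad (f i) M) = diffSpan F M := by
      refine Submodule.eq_of_le_of_finrank_le (Submodule.span_mono ?_) ?_
      · rintro _ ⟨i, rfl⟩
        exact ⟨f i, hfF i, rfl⟩
      · rw [finrank_span_eq_card h1, Fintype.card_fin]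
        exact hmax M
    refine ⟨h1, hspan, ?_⟩
    have h4 := finrank_inf_skewOrthogonal h2
    have h5 : Module.finrank ℝ (diffSpan F M) = Module.finrank ℝ (diffSpan F M₀) := by
      rw [← hspan, finrank_span_eq_card h1, Fintype.card_fin]
      rfl
    omega
  · have := Submodule.finrank_le (diffSpan F M₀)
    omega

theorem isPolyField_grad {n : ℕ} {a : Fin n → ℝ} {f : so n → ℝ}
    (hf : f ∈ laxIntegrals a ∪ noetherIntegrals a) : IsPolyField (grad f) := by
  rcases hf with ⟨k, hk, -, t, rfl⟩ | hf
  · obtain ⟨k, rfl⟩ := Nat.exists_eq_add_of_le' hk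
    intro i j
    simp only [grad_trace_lax_pow]
    exact (polyFun n).mul_mem (const_mem_polyFun _) (isPolyField_id.skewPart_lax_pow a t k i j)
  · obtain ⟨X, -, rfl⟩ := (mem_noetherIntegrals_iff a f).1 hf
    intro i j
    simp only [grad_form]
    exact const_mem_polyFun _

theorem contDiff_of_mem {n : ℕ} {a : Fin n → ℝ} {f : so n → ℝ}
    (hf : f ∈ laxIntegrals a ∪ noetherIntegrals a) : ContDiff ℝ ∞ f := by
  rcases hf with ⟨k, -, -, t, rfl⟩ | ⟨ℓ, rfl⟩
  · exact contDiff_trace_lax_pow a t k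
  · exact contDiff_linearMap (ℓ ∘ₗ proj a)

end Manakov

theorem theorem1 (n : ℕ) (a : Fin n → ℝ) :
    Manakov.IsCompleteNoncommutative
      (Manakov.laxIntegrals a ∪ Manakov.noetherIntegrals a) :=
  ⟨fun _ hf => Manakov.contDiff_of_mem hf, fun _ hf _ hg => Manakov.bracket_mem a hf hg,
    Manakov.generic_isCompleteAt a,
    Manakov.exists_hasDdimDind (fun _ hf => Manakov.isPolyField_grad hf)
      (Manakov.generic_isCompleteAt a)⟩
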